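/- **Setting.** A state on $\mathbb C^d$ is a positive semidefinite $d\times d$ matrix of trace $1$; measuring $\rho$ with a POVM $\{M_x\}$ gives $x$ with probability $\mathrm{Tr}(M_x\rho)$; $\|\cdot\|_1$ is the trace norm. A *maximal MUB* is a family of $d+1$ orthonormal bases $\{\psi^l_x\}_{x\in[d]}$, $l\in[d+1]$, of $\mathbb C^d$ with $|\langle\psi^l_x,\psi^{l'}_y\rangle|^2=1/d$ for all $l\ne l'$ and all $x,y$. Let $p_\rho$ denote the distribution on $[d]\times[d+1]$ given by $p_\rho(x,l)=\frac1{d+1}\langle\psi^l_x|\rho|\psi^l_x\rangle$. For $2\le k<d$ put $\eta=0.01$ and $M=40\lceil\log_2\frac1\eta\rceil\lceil\frac d{k-1}\rceil$. *Simulation protocol.* Each of $M$ players holds an i.i.d. sample from an unknown distribution $p$ on $[d]$ and deterministically sends one of $k$ messages ($\log k$ bits) to a server, which, using private randomness, outputs $\hat X\in[d]\cup\{\bot\}$. The protocol is an $\eta$-simulation if for every $p$: $\Pr(\hat X=\bot)\le\eta$ and $\Pr(\hat X=x\mid\hat X\ne\bot)=p(x)$ for all $x$. *$\ell_2$ identity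 tester* for a known distribution $q$, distance $\varepsilon'$ and error $\delta$: a (possibly randomized) procedure on finite multisets of samples such that for every $p$ and every $N\ge 1000\,\min(\|p\|_2,\|q\|_2)\ln(1/\delta)/\varepsilon'^2$, on $N$ i.i.d. samples from $p$ it outputs YES if $p=q$, and NO if $\|p-q\|_2>\varepsilon'$, with probability at least $1-\delta$. *The algorithm* with $n$ copies of $\rho$ and known $\rho_0$. Form $d+1$ groups, each consisting of $\lfloor n/((d+1)M)\rfloor$ blocks of $M$ copies (excess copies are omitted). Measure each copy of group $l$ in the basis $\{\psi^l_x\}_x$ and compress the outcome of the $i$-th copy of a block to the message that player $i$ of the simulation protocol would send, so that each copy undergoes a fixed $k$-outcome measurement. Decode every block by the server, using independent private randomness, and discard the outputs $\bot$. Draw $\lfloor n/(2M)\rfloor$ independent uniform labels in $[d+1]$, and let $m_l$ be the number of times $l$ occurs. For each $l$ keep the first $m_l$ successful outputs $x$ of group $l$ (all of them if there are fewer), as samples $(x,l)$. Run the $\ell_2$ identity tester for $q=p_{\rho_0}$, $\varepsilon'=\frac{\varepsilon}{(d+1)\sqrt d}$, $\delta=\frac16$ on the multiset of all kept samples and return its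 answer. **Theorem.** There is an absolute constant $C>0$ such that for all integers $2\le k<d$ the following holds. 1. If $d$ is a power of $2$, a maximal MUB of $\mathbb C^d$ exists. There is an $\eta$-simulation protocol with $M$ players and $k$ messages. For every maximal MUB, every state $\rho_0$ and every $0<\varepsilon\le2$ there is an $\ell_2$ identity tester for $q=p_{\rho_0}$ with the above $\varepsilon'$ and $\delta$. 2. For every maximal MUB of $\mathbb C^d$, every state $\rho_0$, every $0<\varepsilon\le 2$, every such simulation protocol and every such tester, and every integer $n\ge C\frac{d^3}{k\varepsilon^2}$, the algorithm uses at most $n$ copies of $\rho$, returns YES with probability at least $2/3$ if $\rho=\rho_0$, and returns NO with probability at least $2/3$ for every state $\rho$ with $\|\rho-\rho_0\|_1>\varepsilon$. -/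

import Mathlib

open scoped BigOperators ENNReal ComplexOrder Matrix

noncomputable section

namespace StateCert

/-! ### Finite probability -/

/-- The law of a family of independent random variables with laws `p i`. -/
def prodPMF {ι X : Type} [Fintype ι] [DecidableEq ι] [Fintype X] (p : ι → PMF X) :
    PMF (ι → X) :=
  PMF.ofFintype (fun x => ∏ i, p i (x i)) (by
    have h := Finset.prod_univ_sum (fun _ : ι => (Finset.univ : Finset X)) (fun i x => p i x)
    rw [Fintype.piFinset_univ] at h
    rw [← h]
    refine Finset.prod_eq_one fun i _ => ?_
    have h1 := (p i).tsum_coe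
    rwa [tsum_fintype] at h1)

/-- The `ℓ₂` norm of a real vector indexed by a finite type. -/
def l2norm {X : Type} [Fintype X] (v : X → ℝ) : ℝ := Real.sqrt (∑ x, v x ^ 2)

/-- The probability vector of a distribution, with real entries. -/
def probVec {X : Type} (p : PMF X) : X → ℝ := fun x => (p x).toReal

/-! ### States and measurements -/

/-- A quantum state on `ℂ^d`. -/
structure DensityMatrix (d : ℕ) where
  mat : Matrix (Fin d) (Fin d) ℂ
  posSemidef : mat.PosSemidef
  trace_eq_one : mat.trace = 1

/-- A POVM on `ℂ^d` with outcome set `X`. -/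
structure POVM (d : ℕ) (X : Type) [Fintype X] where
  effect : X → Matrix (Fin d) (Fin d) ℂ
  posSemidef : ∀ x, (effect x).PosSemidef
  sum_eq_one : ∑ x, effect x = 1

open scoped MatrixOrder Matrix.Norms.L2Operator in
lemma trace_mul_nonneg {d : ℕ} {A B : Matrix (Fin d) (Fin d) ℂ}
    (hA : A.PosSemidef) (hB : B.PosSemidef) : 0 ≤ (A * B).trace := by
  obtain ⟨C, rfl⟩ := CStarAlgebra.nonneg_iff_eq_star_mul_self.mp hB.nonneg
  rw [← Matrix.mul_assoc, Matrix.trace_mul_comm, ← Matrix.mul_assoc]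
  exact (hA.mul_mul_conjTranspose_same C).trace_nonneg

/-- Born's rule: outcome `x` has probability `Tr (M_x ρ)`. -/
def born {d : ℕ} {X : Type} [Fintype X] (𝓜 : POVM d X) (ρ : DensityMatrix d) : PMF X :=
  PMF.ofFintype (fun x => ENNReal.ofReal ((𝓜.effect x * ρ.mat).trace.re)) (by
    have hnn : ∀ x ∈ (Finset.univ : Finset X), 0 ≤ ((𝓜.effect x * ρ.mat).trace.re) := fun x _ =>
      (Complex.nonneg_iff.mp (trace_mul_nonneg (𝓜.posSemidef x) ρ.posSemidef)).1
    rw [← ENNReal.ofReal_sum_of_nonneg hnn, ← Complex.re_sum, ← Matrix.trace_sum,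
      ← Finset.sum_mul, 𝓜.sum_eq_one, Matrix.one_mul, ρ.trace_eq_one]
    simp)

/-- Measure with `𝓜` and report only the value `f x` for the outcome `x`: the effect of `y` is
the sum of the effects `M_x` with `f x = y`. -/
def POVM.coarsen {d : ℕ} {X Y : Type} [Fintype X] [Fintype Y] [DecidableEq Y]
    (𝓜 : POVM d X) (f : X → Y) : POVM d Y where
  effect y := ∑ x with f x = y, 𝓜.effect x
  posSemidef y := Matrix.posSemidef_sum _ fun x _ => 𝓜.posSemidef x
  sum_eq_one := by
    rw [← 𝓜.sum_eq_one]
    exact Finset.sum_fiberwise Finset.univ f 𝓜.effect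

/-- The trace norm: the sum of the singular values, i.e. of the square roots of the eigenvalues
of `Aᴴ A`. -/
def traceNorm {d : ℕ} (A : Matrix (Fin d) (Fin d) ℂ) : ℝ :=
  ∑ i, Real.sqrt ((Matrix.isHermitian_conjTranspose_mul_self A).eigenvalues i)

/-- The output law (`true` is `YES`) of a test that applies the fixed `k`-outcome POVM `𝓜 c` to
copy `c` of `ρ`, all copies being measured separately, and then passes the list of outcomes to a
classical, possibly randomized, procedure `post`. -/
def testOutput {d k : ℕ} {ι : Type} [Fintype ι] [DecidableEq ι]
    (𝓜 : ι → POVM d (Fin k)) (post : (ι → Fin k) → PMF Bool) (ρ : DensityMatrix d) : PMF Bool :=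
  (prodPMF fun c => born (𝓜 c) ρ).bind post

/-- The test decides between `ρ = ρ₀` and `‖ρ - ρ₀‖₁ > ε`, being correct with probability at
least `2/3` for every state `ρ` of one of the two kinds. -/
def Certifies {d k : ℕ} {ι : Type} [Fintype ι] [DecidableEq ι]
    (𝓜 : ι → POVM d (Fin k)) (post : (ι → Fin k) → PMF Bool)
    (ρ₀ : DensityMatrix d) (ε : ℝ) : Prop :=
  2 / 3 ≤ testOutput 𝓜 post ρ₀ true ∧
  ∀ ρ : DensityMatrix d, ε < traceNorm (ρ.mat - ρ₀.mat) → 2 / 3 ≤ testOutput 𝓜 post ρ false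

/-! ### Mutually unbiased bases -/

/-- `d + 1` orthonormal bases of `ℂ^d`. -/
abbrev BasisFamily (d : ℕ) : Type :=
  Fin (d + 1) → OrthonormalBasis (Fin d) ℂ (EuclideanSpace ℂ (Fin d))

/-- The `d + 1` bases form a maximal MUB: vectors of different bases satisfy
`|⟨ψ, φ⟩|² = 1 / d`. -/
def IsMaximalMUB {d : ℕ} (B : BasisFamily d) : Prop :=
  ∀ l l', l ≠ l' → ∀ x y, ‖inner ℂ (B l x) (B l' y)‖ ^ 2 = 1 / (d : ℝ)

/-- The rank-one projection `|ψ⟩⟨ψ|` for a unit vector `ψ`. -/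
def ketbra {d : ℕ} (ψ : EuclideanSpace ℂ (Fin d)) : Matrix (Fin d) (Fin d) ℂ :=
  Matrix.vecMulVec (fun i => ψ i) (star fun i => ψ i)

lemma sum_ketbra {d : ℕ} (b : OrthonormalBasis (Fin d) ℂ (EuclideanSpace ℂ (Fin d))) :
    ∑ x, ketbra (b x) = 1 := by
  ext i j
  have h := b.sum_inner_mul_inner (EuclideanSpace.single i (1 : ℂ))
    (EuclideanSpace.single j (1 : ℂ))
  rw [Matrix.sum_apply]
  simp only [EuclideanSpace.inner_single_left, EuclideanSpace.inner_single_right] at h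
  simpa [ketbra, Matrix.vecMulVec_apply, Matrix.one_apply, eq_comm] using h

/-- The measurement in the orthonormal basis `b`. -/
def basisPOVM {d : ℕ} (b : OrthonormalBasis (Fin d) ℂ (EuclideanSpace ℂ (Fin d))) :
    POVM d (Fin d) where
  effect x := ketbra (b x)
  posSemidef _ := Matrix.posSemidef_vecMulVec_self_star _
  sum_eq_one := sum_ketbra b

/-- The POVM with the `d (d + 1)` effects `|ψ_x^l⟩⟨ψ_x^l| / (d + 1)`. -/
def mubPOVM {d : ℕ} (B : BasisFamily d) : POVM d (Fin d × Fin (d + 1)) where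
  effect xl := ((d : ℝ) + 1)⁻¹ • ketbra (B xl.2 xl.1)
  posSemidef _ := (Matrix.posSemidef_vecMulVec_self_star _).smul (by positivity)
  sum_eq_one := by
    rw [Fintype.sum_prod_type_right]
    simp only [← Finset.smul_sum, sum_ketbra]
    simp only [Finset.sum_const, Finset.card_univ, Fintype.card_fin]
    rw [← Nat.cast_smul_eq_nsmul ℝ, smul_smul]
    have h : ((d + 1 : ℕ) : ℝ) * ((d : ℝ) + 1)⁻¹ = 1 := by
      push_cast
      exact mul_inv_cancel₀ (by positivity)
    rw [mul_comm, h, one_smul]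

/-! ### Distributed simulation -/

/-- `M` players each hold an element of `[d]`. Player `i` deterministically sends one of `k`
messages (`log k` bits) to a server, which, using private randomness, outputs an element of `[d]`
or the failure symbol `none`. -/
structure SimProtocol (d k M : ℕ) where
  enc : Fin M → Fin d → Fin k
  dec : (Fin M → Fin k) → PMF (Option (Fin d))

/-- The law of the server's output when the players hold i.i.d. samples from `p`. -/
def SimProtocol.output {d k M : ℕ} (S : SimProtocol d k M) (p : PMF (Fin d)) :
    PMF (Option (Fin d)) :=
  (prodPMF fun _ : Fin M => p).bind fun x => S.dec fun i => S.enc i (x i)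

/-- `η`-simulation: for every `p`, the output fails with probability at most `η` and, conditioned
on not failing, it has law `p`. -/
def SimProtocol.Simulates {d k M : ℕ} (S : SimProtocol d k M) (η : ℝ) : Prop :=
  ∀ p : PMF (Fin d), S.output p none ≤ ENNReal.ofReal η ∧
    ∀ x, S.output p (some x) / (1 - S.output p none) = p x

/-- The number `40 ⌈log₂ (1/η)⌉ ⌈d / (k - 1)⌉` of players, with `η = 0.01`. -/
def numPlayers (d k : ℕ) : ℕ :=
  40 * ⌈Real.logb 2 (1 / 0.01)⌉₊ * ⌈(d : ℝ) / ((k : ℝ) - 1)⌉₊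

/-! ### Identity testing in `ℓ₂` -/

/-- The law of the multiset formed by `N` i.i.d. samples from `p`. -/
def iidSamples {X : Type} [Fintype X] (p : PMF X) (N : ℕ) : PMF (Multiset X) :=
  (prodPMF fun _ : Fin N => p).map fun x => (List.ofFn x : Multiset X)

/-- `T` is an `ℓ₂` identity tester for the known distribution `q`, with distance `ε` and error
probability `δ`: given at least `1000 b log (1/δ) / ε²` i.i.d. samples from an unknown `p`, where
`b = min (‖p‖₂, ‖q‖₂)`, it says `YES` if `p = q` and `NO` if `‖p - q‖₂ > ε`, each with
probability at least `1 - δ`. -/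
def IsL2IdentityTester {X : Type} [Fintype X] (T : Multiset X → PMF Bool) (q : PMF X)
    (ε δ : ℝ) : Prop :=
  ∀ (p : PMF X) (N : ℕ),
    1000 * min (l2norm (probVec p)) (l2norm (probVec q)) * Real.log (1 / δ) / ε ^ 2 ≤ N →
    (p = q → ENNReal.ofReal (1 - δ) ≤ (iidSamples p N).bind T true) ∧
    (ε < l2norm (probVec p - probVec q) →
      ENNReal.ofReal (1 - δ) ≤ (iidSamples p N).bind T false)

/-! ### The algorithm -/

/-- The copies that the algorithm measures when `n` are available: `d + 1` equal groups, each
divided into equal blocks of `M` players. Excess copies are omitted. -/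
abbrev Copies (d M n : ℕ) : Type := Fin (d + 1) × Fin (n / ((d + 1) * M)) × Fin M

/-- The copy `(l, j, i)` is measured in basis `l`, and the outcome is compressed to the message
that player `i` of the simulation protocol sends. -/
def algMeasurement {d k M : ℕ} (B : BasisFamily d) (S : SimProtocol d k M) (n : ℕ) :
    Copies d M n → POVM d (Fin k) :=
  fun c => (basisPOVM (B c.1)).coarsen (S.enc c.2.2)

/-- Let `m_l` be the number of times that `l` appears among the labels `L`. From the simulated
outputs of group `l`, discard the failures and keep the first `m_l` of the rest (all of them if
there are fewer); collect the result over all `l`. -/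
def collect {d R N : ℕ} (xhat : Fin (d + 1) × Fin R → Option (Fin d)) (L : Fin N → Fin (d + 1)) :
    Multiset (Fin d × Fin (d + 1)) :=
  ∑ l, ((((List.ofFn fun j => xhat (l, j)).reduceOption.take
    (Finset.univ.filter fun t => L t = l).card).map fun x => (x, l) : List _) : Multiset _)

/-- The classical part of the algorithm: the server decodes every block of messages, draws
`⌊n / (2M)⌋` independent uniform labels, and runs the tester `T` on the collected samples. -/
def algPost {d k M : ℕ} (S : SimProtocol d k M) (T : Multiset (Fin d × Fin (d + 1)) → PMF Bool)
    (n : ℕ) (y : Copies d M n → Fin k) : PMF Bool :=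
  (prodPMF fun lj : Fin (d + 1) × Fin (n / ((d + 1) * M)) =>
      S.dec fun i => y (lj.1, lj.2, i)).bind fun xhat =>
    (prodPMF fun _ : Fin (n / (2 * M)) => PMF.uniformOfFintype (Fin (d + 1))).bind fun L =>
      T (collect xhat L)

end StateCert

end

open StateCert

/-! The vectors of a maximal MUB form a complex projective 2-design. Contracting the design identity
with a matrix gives ‖p_ρ - p_σ‖₂ = ‖ρ - σ‖_F / (d + 1) and ‖p_ρ‖₂² = (1 + ‖ρ‖_F²) / (d + 1)²
(`sum_tensorFour`, `sum_norm_trace_ketbra_sq`). Since ‖A‖₁ ≤ √d ‖A‖_F, states at trace distance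
above ε have outcome laws at ℓ₂ distance above ε', while ‖p_{ρ₀}‖₂ is of order 1/d. An ℓ₂ tester
thus needs of order d²/ε² samples. Each costs O(M) = O(d/k) copies, whence d³/(kε²).

The tester expects i.i.d. samples from p_ρ. A simulated output is a genuine sample, erased
independently of its value (`output_eq_bind`). If every group has enough successes, the kept samples
therefore sit at positions determined by the labels and the success pattern alone, so they are
independent (`exists_collect_eq`, `expect_collect_eq`); averaging over the uniform labels makes them
i.i.d. from p_ρ (`expect_labels_eq`). A group has R blocks and about R/2 requested samples on
average, so Chebyshev and a union bound over the d + 1 groups bound the probability of a shortage by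
1/6 (`expect_not_enough_le`). The success probability is at least 5/6 - 1/6 = 2/3 (`testOutput_ge`).

The ingredients: for d = 2^a, the standard basis together with d bases of phase vectors built from
ℤ/4-valued quadratic forms on the field with d elements is a maximal MUB, because the inner products
are Gauss sums of modulus √d divided by d. A simulation round assigns two players to each block of k
- 1 symbols and succeeds with probability at least 1/4; rounds are repeated until one succeeds. The
tester thresholds the collision U-statistic, an unbiased estimate of N(N - 1)‖p - q‖₂², and
Chebyshev controls its error. -/

open StateCert

/-! ### Independent families: kernels, marginals and blocks -/

section ProductLaws

variable {ι X Y : Type} [Fintype ι] [DecidableEq ι] [Fintype X] [Fintype Y]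

lemma prodPMF_apply (p : ι → PMF X) (x : ι → X) : prodPMF p x = ∏ i, p i (x i) := rfl

lemma sum_piFinset_prodPMF (p : ι → PMF X) (t : ι → Finset X) :
    ∑ x ∈ Fintype.piFinset t, prodPMF p x = ∏ i, ∑ a ∈ t i, p i a :=
  (Finset.prod_univ_sum t fun i a => p i a).symm

lemma pmf_sum_eq_one (p : PMF X) : ∑ x, p x = 1 := by
  have h := p.tsum_coe
  rwa [tsum_fintype] at h

/-- Passing independent variables through independent kernels keeps them independent. -/
lemma prodPMF_bind (p : ι → PMF X) (K : ι → X → PMF Y) :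
    (prodPMF p).bind (fun x => prodPMF fun i => K i (x i)) = prodPMF fun i => (p i).bind (K i) := by
  ext y
  rw [PMF.bind_apply, tsum_fintype, prodPMF_apply]
  simp only [PMF.bind_apply, tsum_fintype, prodPMF_apply]
  rw [Finset.prod_univ_sum, Fintype.piFinset_univ]
  simp only [Finset.prod_mul_distrib]

lemma prodPMF_pure (f : ι → X) : prodPMF (fun i => PMF.pure (f i)) = PMF.pure f := by
  classical
  ext y
  rw [prodPMF_apply]
  simp only [PMF.pure_apply]
  by_cases h : y = f
  · simp [h]
  · obtain ⟨i, hi⟩ := Function.ne_iff.mp h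
    rw [if_neg h]
    exact Finset.prod_eq_zero (Finset.mem_univ i) (if_neg hi)

lemma prodPMF_map (p : ι → PMF X) (f : ι → X → Y) :
    (prodPMF p).map (fun x i => f i (x i)) = prodPMF fun i => (p i).map (f i) := by
  have h := prodPMF_bind p fun i a => PMF.pure (f i a)
  simp only [prodPMF_pure] at h
  exact h

/-- The marginal law of a subfamily. -/
lemma prodPMF_map_comp {κ : Type} [Fintype κ] [DecidableEq κ] (p : ι → PMF X) (e : κ → ι)
    (he : Function.Injective e) :
    (prodPMF p).map (fun x => x ∘ e) = prodPMF (p ∘ e) := by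
  classical
  ext y
  rw [PMF.map_apply, tsum_fintype]
  -- The fibre over `y` is a box: the coordinate `e t` is pinned to `y t` and coordinates outside
  -- the range of `e` are free. The product formula then applies, and every free coordinate
  -- contributes the factor 1.
  have hset : (Finset.univ.filter fun x : ι → X => y = x ∘ e) =
      Fintype.piFinset fun i => Finset.univ.filter fun a => ∀ t, e t = i → y t = a := by
    ext x
    simp only [Finset.mem_filter, Finset.mem_univ, true_and, Fintype.mem_piFinset, funext_iff,
      Function.comp_apply]
    constructor
    · rintro h i t rfl; exact h t
    · intro h t; exact h _ t rfl
  have hsum := Finset.sum_filter (s := Finset.univ) (fun x : ι → X => y = x ∘ e) (prodPMF p)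
  rw [hset, sum_piFinset_prodPMF] at hsum
  refine Eq.trans (Finset.sum_congr rfl fun x _ => ?_) (hsum.symm.trans ?_)
  · congr
  rw [prodPMF_apply]
  symm
  refine Fintype.prod_of_injective e he _ _ ?_ ?_
  · intro i hi
    rw [Finset.filter_true_of_mem, pmf_sum_eq_one]
    intro a _ t ht
    exact absurd ⟨t, ht⟩ hi
  · intro t
    have : (Finset.univ.filter fun a => ∀ t', e t' = e t → y t' = a) = {y t} := by
      ext a
      simp only [Finset.mem_filter, Finset.mem_univ, true_and, Finset.mem_singleton]
      constructor
      · intro h; exact (h t rfl).symm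
      · rintro rfl t' ht'; rw [he ht']
    rw [this, Finset.sum_singleton]; rfl

lemma pmf_map_equiv_apply {X Y : Type} (p : PMF X) (e : X ≃ Y) (y : Y) : p.map e y = p (e.symm y) := by
  rw [PMF.map_apply, tsum_eq_single (e.symm y)]
  · simp
  · intro x hx
    rw [if_neg]
    rintro rfl
    simp at hx

/-- Grouping independent variables into blocks. -/
lemma prodPMF_map_blocks {α β : Type} [Fintype α] [DecidableEq α] [Fintype β] [DecidableEq β]
    (p : ι → PMF X) (e : α × β ≃ ι) :
    (prodPMF p).map (fun x a b => x (e (a, b))) = prodPMF fun a => prodPMF fun b => p (e (a, b)) := by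
  ext z
  have h := pmf_map_equiv_apply (prodPMF p)
    ((Equiv.arrowCongr e.symm (Equiv.refl X)).trans (Equiv.curry α β X)) z
  refine Eq.trans h ?_
  simp only [prodPMF_apply]
  rw [← Fintype.prod_prod_type' fun a b => p (e (a, b)) (z a b), ← e.prod_comp]
  refine Finset.prod_congr rfl fun ab _ => ?_
  simp [Equiv.arrowCongr, Function.uncurry]

end ProductLaws

/-! ### Expectations, Chebyshev's inequality and second moments -/

section Expectation

variable {X Y : Type} [Fintype X] [Fintype Y]

/-- The expectation of `f` under a distribution on a finite type. -/
noncomputable def expect (p : PMF X) (f : X → ℝ) : ℝ := ∑ x, (p x).toReal * f x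

lemma sum_toReal_eq_one (p : PMF X) : ∑ x, (p x).toReal = 1 := by
  rw [← ENNReal.toReal_sum fun x _ => p.apply_ne_top x, pmf_sum_eq_one, ENNReal.toReal_one]

lemma expect_const (p : PMF X) (c : ℝ) : expect p (fun _ => c) = c := by
  rw [expect, ← Finset.sum_mul, sum_toReal_eq_one, one_mul]

lemma expect_add (p : PMF X) (f g : X → ℝ) :
    expect p (fun x => f x + g x) = expect p f + expect p g := by
  simp only [expect, mul_add, Finset.sum_add_distrib]

lemma expect_sub (p : PMF X) (f g : X → ℝ) :
    expect p (fun x => f x - g x) = expect p f - expect p g := by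
  simp only [expect, mul_sub, Finset.sum_sub_distrib]

lemma expect_mul_left (p : PMF X) (c : ℝ) (f : X → ℝ) :
    expect p (fun x => c * f x) = c * expect p f := by
  simp only [expect, Finset.mul_sum]
  exact Finset.sum_congr rfl fun x _ => by ring

lemma expect_sum {α : Type} (s : Finset α) (p : PMF X) (f : α → X → ℝ) :
    expect p (fun x => ∑ a ∈ s, f a x) = ∑ a ∈ s, expect p (f a) := by
  simp only [expect, Finset.mul_sum]
  exact Finset.sum_comm

lemma expect_mono (p : PMF X) {f g : X → ℝ} (h : ∀ x, f x ≤ g x) : expect p f ≤ expect p g :=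
  Finset.sum_le_sum fun x _ => mul_le_mul_of_nonneg_left (h x) ENNReal.toReal_nonneg

lemma expect_nonneg (p : PMF X) {f : X → ℝ} (h : ∀ x, 0 ≤ f x) : 0 ≤ expect p f :=
  Finset.sum_nonneg fun x _ => mul_nonneg ENNReal.toReal_nonneg (h x)

lemma expect_comm (p : PMF X) (q : PMF Y) (f : X → Y → ℝ) :
    expect p (fun x => expect q (f x)) = expect q fun y => expect p fun x => f x y := by
  simp only [expect, Finset.mul_sum]
  rw [Finset.sum_comm]
  exact Finset.sum_congr rfl fun _ _ => Finset.sum_congr rfl fun _ _ => by ring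

lemma toReal_bind_apply {Z : Type} (p : PMF X) (K : X → PMF Z) (z : Z) :
    (p.bind K z).toReal = expect p fun x => (K x z).toReal := by
  rw [PMF.bind_apply, tsum_fintype, ENNReal.toReal_sum fun x _ =>
    ENNReal.mul_ne_top (p.apply_ne_top x) ((K x).apply_ne_top z)]
  simp only [ENNReal.toReal_mul, expect]

lemma expect_bind (p : PMF X) (K : X → PMF Y) (f : Y → ℝ) :
    expect (p.bind K) f = expect p fun x => expect (K x) f := by
  simp only [expect, toReal_bind_apply, Finset.mul_sum, Finset.sum_mul]
  rw [Finset.sum_comm]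
  exact Finset.sum_congr rfl fun _ _ => Finset.sum_congr rfl fun _ _ => by ring

lemma expect_pure (a : X) (f : X → ℝ) : expect (PMF.pure a) f = f a := by
  classical
  simp only [expect, PMF.pure_apply]
  rw [Finset.sum_eq_single a] <;> simp +contextual

lemma expect_map (p : PMF X) (g : X → Y) (f : Y → ℝ) :
    expect (p.map g) f = expect p fun x => f (g x) := by
  rw [← PMF.bind_pure_comp, expect_bind]
  simp only [Function.comp_apply, expect_pure]

lemma toReal_apply_le_one {Z : Type} (p : PMF Z) (z : Z) : (p z).toReal ≤ 1 :=
  ENNReal.toReal_le_of_le_ofReal zero_le_one (by simpa using p.coe_le_one z)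

/-- Chebyshev's inequality. -/
lemma expect_ite_le_sq_div (p : PMF X) (P : X → Prop) [DecidablePred P] (f : X → ℝ) {t : ℝ}
    (ht : 0 < t) (h : ∀ x, P x → t ≤ |f x|) :
    expect p (fun x => if P x then 1 else 0) ≤ expect p (fun x => f x ^ 2) / t ^ 2 := by
  rw [div_eq_inv_mul, ← expect_mul_left]
  refine expect_mono p fun x => ?_
  split_ifs with hx
  · rw [← div_eq_inv_mul, one_le_div (by positivity), ← sq_abs (f x)]
    exact pow_le_pow_left₀ ht.le (h x hx) 2
  · positivity

variable {ι : Type} [Fintype ι] [DecidableEq ι]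

lemma expect_prodPMF_prod (p : ι → PMF X) (φ : ι → X → ℝ) :
    expect (prodPMF p) (fun x => ∏ i, φ i (x i)) = ∏ i, expect (p i) (φ i) := by
  simp only [expect, prodPMF_apply, ENNReal.toReal_prod, ← Finset.prod_mul_distrib]
  rw [Finset.prod_univ_sum, Fintype.piFinset_univ]

lemma expect_prodPMF_apply (p : ι → PMF X) (i : ι) (g : X → ℝ) :
    expect (prodPMF p) (fun x => g (x i)) = expect (p i) g := by
  -- A function of one coordinate is a product whose other factors are all 1.
  have h := expect_prodPMF_prod p fun k a => if k = i then g a else 1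
  have h2 : ∀ k, expect (p k) (fun a => if k = i then g a else 1) =
      if k = i then expect (p i) g else 1 := by
    intro k
    split_ifs with hk
    · rw [hk]
    · exact expect_const _ _
  simpa only [h2, Finset.prod_ite_eq', Finset.mem_univ, if_true] using h

lemma expect_prodPMF_mul_eq_zero (p : ι → PMF X) {i j : ι} (hij : i ≠ j) (g h : X → ℝ)
    (hg : expect (p i) g = 0) :
    expect (prodPMF p) (fun x => g (x i) * h (x j)) = 0 := by
  have h' := expect_prodPMF_prod p fun k a => (if k = i then g a else 1) * if k = j then h a else 1
  simp only [Finset.prod_mul_distrib, Finset.prod_ite_eq', Finset.mem_univ, if_true] at h'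
  rw [h']
  refine Finset.prod_eq_zero (Finset.mem_univ i) ?_
  simpa [hij] using hg

/-- The second moment of a sum of independent centred variables. -/
lemma expect_sum_sq (p : ι → PMF X) (s : Finset ι) (f : ι → X → ℝ)
    (hf : ∀ i ∈ s, expect (p i) (f i) = 0) :
    expect (prodPMF p) (fun x => (∑ i ∈ s, f i (x i)) ^ 2) =
      ∑ i ∈ s, expect (p i) fun a => f i a ^ 2 := by
  simp only [sq, Finset.sum_mul_sum]
  rw [expect_sum]
  refine Finset.sum_congr rfl fun i hi => ?_
  rw [expect_sum, Finset.sum_eq_single i]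
  · exact expect_prodPMF_apply p i fun a => f i a * f i a
  · intro j _ hj
    exact expect_prodPMF_mul_eq_zero p hj.symm (f i) (f j) (hf i hi)
  · exact fun h => absurd hi h

/-- Splitting off the first of several i.i.d. samples. -/
lemma expect_prodPMF_succ (p : PMF X) (N : ℕ) (f : (Fin (N + 1) → X) → ℝ) :
    expect (prodPMF fun _ : Fin (N + 1) => p) f =
      expect p fun a => expect (prodPMF fun _ : Fin N => p) fun x => f (Fin.cons a x) := by
  simp only [expect]
  rw [← (Fin.consEquiv fun _ => X).sum_comp, Fintype.sum_prod_type]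
  refine Finset.sum_congr rfl fun a _ => ?_
  rw [Finset.mul_sum]
  refine Finset.sum_congr rfl fun x _ => ?_
  have hc : (Fin.consEquiv fun _ => X) (a, x) = (Fin.cons a x : Fin (N + 1) → X) := rfl
  simp only [hc, prodPMF_apply, Fin.prod_univ_succ, Fin.cons_zero, Fin.cons_succ,
    ENNReal.toReal_mul]
  ring

end Expectation

/-! ### Maximal MUBs in dimension 2^a from quadratic forms over a finite field -/

section MUBExistence

/-- The embedding `t ↦ 2 t` of `ℤ/2` into `ℤ/4`. -/
def doubleHom : ZMod 2 →+ ZMod 4 where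
  toFun t := 2 * (t.val : ZMod 4)
  map_zero' := by decide
  map_add' := by decide

lemma doubleHom_eq_zero {t : ZMod 2} (h : doubleHom t = 0) : t = 0 := by
  revert t; decide

lemma doubleHom_mul (s t u : ZMod 2) :
    doubleHom (s * t * u) = 2 * ((s.val : ZMod 4) * (t.val : ZMod 4) * (u.val : ZMod 4)) := by
  revert s t u; decide

/-- The integer carry is `s + t - 2st`, and -2 = 2 modulo 4. This correction is the reason that
diagonal forms, which have no refinement over ℤ/2, have one over ℤ/4. -/
lemma val_add_zmod_two (s t : ZMod 2) :
    ((s + t).val : ZMod 4) = s.val + t.val + 2 * (s.val * t.val) := by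
  revert s t; decide

lemma quarter_expansion (S a b c e : ZMod 4) :
    S * (a + b + 2 * (a * b)) * (c + e + 2 * (c * e)) =
      S * a * c + S * b * e + (S * a * e + S * b * c) +
        2 * (S * (a * b) * (c + e) + S * (c * e) * (a + b)) := by
  have h4 : (4 : ZMod 4) = 0 := by decide
  linear_combination S * (a * b) * (c * e) * h4

/-- Every symmetric bilinear form over `ℤ/2` has a `ℤ/4`-valued quadratic refinement. -/
lemma exists_quadratic_refinement {V : Type} [AddCommGroup V] [Module (ZMod 2) V]
    [FiniteDimensional (ZMod 2) V] (β : LinearMap.BilinForm (ZMod 2) V)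
    (hβ : ∀ y z, β y z = β z y) :
    ∃ Q : V → ZMod 4, ∀ y z, Q (y + z) = Q y + Q z + doubleHom (β y z) := by
  let b := Module.finBasis (ZMod 2) V
  let S : Fin _ → Fin _ → ZMod 4 := fun i j => ((β (b i) (b j)).val : ZMod 4)
  have hS : ∀ i j, S i j = S j i := fun i j => by simp only [S, hβ (b i)]
  let r : V → Fin _ → ZMod 4 := fun y i => ((b.repr y i).val : ZMod 4)
  refine ⟨fun y => ∑ i, ∑ j, S i j * r y i * r y j, fun y z => ?_⟩
  have hr : ∀ i, r (y + z) i = r y i + r z i + 2 * (r y i * r z i) := fun i => by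
    simp only [r, map_add, Finsupp.add_apply, val_add_zmod_two]
  have hB : doubleHom (β y z) = 2 * ∑ i, ∑ j, S i j * r y i * r z j := by
    conv_lhs => rw [← b.sum_repr y, ← b.sum_repr z]
    simp only [map_sum, LinearMap.sum_apply, map_smul, LinearMap.smul_apply, smul_eq_mul,
      Finset.mul_sum]
    rw [Finset.sum_comm]
    refine Finset.sum_congr rfl fun i _ => Finset.sum_congr rfl fun j _ => ?_
    rw [← doubleHom_mul]
    congr 1
    ring
  -- By symmetry of `S` the two mixed sums agree, and together they are 2 times one of them, which
  -- is `doubleHom (β y z)`. The two cubic carry sums agree as well; they already have the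
  -- coefficient 2, so they add up to a multiple of 4.
  have h1 : ∑ i, ∑ j, S i j * r z i * r y j = ∑ i, ∑ j, S i j * r y i * r z j := by
    rw [Finset.sum_comm]
    refine Finset.sum_congr rfl fun i _ => Finset.sum_congr rfl fun j _ => ?_
    rw [hS]; ring
  have h2 : ∑ i, ∑ j, S i j * (r y j * r z j) * (r y i + r z i) =
      ∑ i, ∑ j, S i j * (r y i * r z i) * (r y j + r z j) := by
    rw [Finset.sum_comm]
    refine Finset.sum_congr rfl fun i _ => Finset.sum_congr rfl fun j _ => ?_
    rw [hS]
  have h4 : (4 : ZMod 4) = 0 := by decide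
  simp only [hr, quarter_expansion, Finset.sum_add_distrib, ← Finset.mul_sum]
  rw [h1, h2, hB]
  linear_combination (∑ i, ∑ j, S i j * (r y i * r z i) * (r y j + r z j)) * h4

/-- The standard character of `ℤ/4`. -/
noncomputable def quarterChar : AddChar (ZMod 4) ℂ := ZMod.stdAddChar

lemma star_quarterChar (t : ZMod 4) : star (quarterChar t) = quarterChar (-t) := by
  rw [AddChar.map_neg_eq_inv, Complex.inv_def, Complex.normSq_eq_norm_sq,
    AddChar.norm_apply]
  simp

/-- The summand is the character (-1)^(f y) of `V`, which is nontrivial because of `z`. -/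
lemma sum_quarterChar_double {V : Type} [AddCommGroup V] [Fintype V] [DecidableEq V]
    (f : V →+ ZMod 2) {z : V} (hz : f z ≠ 0) : ∑ y, quarterChar (doubleHom (f y)) = 0 := by
  refine AddChar.sum_eq_zero_of_ne_one
    (ψ := quarterChar.compAddMonoidHom (doubleHom.comp f)) fun h => hz ?_
  have h1 : quarterChar (doubleHom (f z)) = 1 := by
    simpa using congrArg (fun ψ : AddChar V ℂ => ψ z) h
  refine doubleHom_eq_zero (ZMod.injective_stdAddChar (N := 4) ?_)
  exact h1.trans (AddChar.map_zero_eq_one _).symm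

/-- The absolute value of a quadratic Gauss sum. -/
lemma norm_sq_gauss_sum {V : Type} [AddCommGroup V] [Fintype V] [DecidableEq V]
    (G : V → ZMod 4) (β : V → V →+ ZMod 2)
    (hG : ∀ y z, G (y + z) = G y + G z + doubleHom (β y z))
    (hβ : ∀ y, y ≠ 0 → ∃ z, β y z ≠ 0) (h0 : ∀ z, β 0 z = 0) :
    ‖∑ y, quarterChar (G y)‖ ^ 2 = Fintype.card V := by
  have hG0 : G 0 = 0 := by
    have h := hG 0 0
    rw [map_zero, map_zero, add_zero, add_zero] at h
    simpa using h
  have key : star (∑ z, quarterChar (G z)) * ∑ y, quarterChar (G y) = Fintype.card V := by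
    rw [star_sum, Finset.sum_mul]
    -- Shifting `y` by `z` cancels the term `G z` and leaves the pairing with `z`. Summing over `z`
    -- then kills every `y` except 0, by nondegeneracy.
    have h1 : ∀ z, star (quarterChar (G z)) * ∑ y, quarterChar (G y) =
        ∑ y, quarterChar (G y) * quarterChar (doubleHom (β y z)) := by
      intro z
      rw [Finset.mul_sum, ← Equiv.sum_comp (Equiv.addRight z)]
      refine Finset.sum_congr rfl fun y _ => ?_
      rw [star_quarterChar, Equiv.coe_addRight, hG, ← AddChar.map_add_eq_mul,
        ← AddChar.map_add_eq_mul]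
      congr 1
      ring
    simp only [h1]
    rw [Finset.sum_comm]
    simp only [← Finset.mul_sum]
    rw [Finset.sum_eq_single 0]
    · simp [hG0, h0, AddChar.map_zero_eq_one]
    · intro y _ hy
      obtain ⟨z, hz⟩ := hβ y hy
      rw [sum_quarterChar_double (β y) hz, mul_zero]
    · simp
  have h2 := Complex.conj_mul' (∑ y, quarterChar (G y))
  rw [← Complex.ofReal_inj]
  push_cast
  rw [← h2]
  exact key

/-- The coefficients of the vectors of the basis that belongs to the quadratic form `Q`. -/
noncomputable def phaseVector {K : Type} [Field K] [Algebra (ZMod 2) K] {d : ℕ} (e : K ≃ Fin d)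
    (Q : K → ZMod 4) (x : Fin d) : EuclideanSpace ℂ (Fin d) :=
  WithLp.toLp 2 fun i => ((Real.sqrt d)⁻¹ : ℂ) *
    quarterChar (Q (e.symm i) + doubleHom (Algebra.trace (ZMod 2) K (e.symm x * e.symm i)))

variable {K : Type} [Field K] [Algebra (ZMod 2) K] {d : ℕ}

/-- Both orthonormality (equal forms, a character sum) and unbiasedness (distinct forms, a Gauss
sum) are read off from this formula. -/
lemma inner_phaseVector [Fintype K] (e : K ≃ Fin d) (Q Q' : K → ZMod 4) (x x' : Fin d) :
    inner ℂ (phaseVector e Q x) (phaseVector e Q' x') = ((d : ℂ))⁻¹ *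
      ∑ y, quarterChar (Q' y - Q y +
        doubleHom (Algebra.trace (ZMod 2) K ((e.symm x' - e.symm x) * y))) := by
  rw [EuclideanSpace.inner_eq_star_dotProduct, dotProduct, ← e.sum_comp, Finset.mul_sum]
  refine Finset.sum_congr rfl fun y _ => ?_
  simp only [phaseVector, Pi.star_apply, star_mul', star_quarterChar, Equiv.symm_apply_apply]
  have hs : star ((Real.sqrt d)⁻¹ : ℂ) = ((Real.sqrt d)⁻¹ : ℂ) := by
    rw [← Complex.ofReal_inv]; exact Complex.conj_ofReal _
  have hd : ((Real.sqrt d)⁻¹ : ℂ) * ((Real.sqrt d)⁻¹ : ℂ) = (d : ℂ)⁻¹ := by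
    rw [← mul_inv, ← Complex.ofReal_mul, Real.mul_self_sqrt (Nat.cast_nonneg d)]
    simp
  rw [hs, mul_mul_mul_comm, hd, ← AddChar.map_add_eq_mul]
  congr 2
  rw [sub_mul, map_sub, map_sub]
  ring

/-- All coordinates of a phase vector have modulus 1/√d. This makes the standard basis the last of
the `d + 1` bases. -/
lemma norm_inner_phaseVector_basisFun (e : K ≃ Fin d) (Q : K → ZMod 4) (x y : Fin d) :
    ‖inner ℂ (phaseVector e Q x) (EuclideanSpace.basisFun (Fin d) ℂ y)‖ ^ 2 = 1 / (d : ℝ) := by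
  rw [EuclideanSpace.basisFun_apply, EuclideanSpace.inner_single_right]
  simp only [phaseVector, one_mul, RCLike.norm_conj, norm_mul, AddChar.norm_apply, mul_one,
    norm_inv, Complex.norm_real, Real.norm_eq_abs, inv_pow, sq_abs, one_div,
    Real.sq_sqrt (Nat.cast_nonneg d)]

lemma exists_trace_mul_ne_zero [Finite K] {c : K} (hc : c ≠ 0) :
    ∃ y, Algebra.trace (ZMod 2) K (c * y) ≠ 0 := by
  have h := (traceForm_nondegenerate (ZMod 2) K).1
  by_contra! hy
  exact hc (h c hy)

lemma orthonormal_phaseVector [Fintype K] (e : K ≃ Fin d) (Q : K → ZMod 4) :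
    Orthonormal ℂ (phaseVector e Q) := by
  classical
  have hd : (d : ℂ) ≠ 0 := by
    have : d = Fintype.card K := by rw [Fintype.card_congr e, Fintype.card_fin]
    rw [this]
    exact_mod_cast Fintype.card_ne_zero
  have hcard : (Fintype.card K : ℂ) = d := by rw [Fintype.card_congr e, Fintype.card_fin]
  rw [orthonormal_iff_ite]
  intro x x'
  rw [inner_phaseVector]
  split_ifs with h
  · simp [h, AddChar.map_zero_eq_one, hcard, hd]
  · simp only [sub_self, zero_add]
    have hne : e.symm x' - e.symm x ≠ 0 := sub_ne_zero.mpr fun h' => h (e.symm.injective h').symm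
    obtain ⟨y, hy⟩ := exists_trace_mul_ne_zero hne
    exact mul_eq_zero_of_right _ (sum_quarterChar_double
      (((Algebra.trace (ZMod 2) K).toAddMonoidHom).comp
        (AddMonoidHom.mulLeft (e.symm x' - e.symm x))) (z := y) hy)

/-- The difference of the two refinements is a refinement of Tr((c' - c) y z), nondegenerate for
distinct parameters; the linear terms coming from `x` and `x'` do not change this polarization. The
Gauss sum therefore has squared modulus `d`, and the prefactor contributes 1/d². -/
lemma norm_inner_phaseVector [Fintype K] (e : K ≃ Fin d) (Q : K → K → ZMod 4)
    (hQ : ∀ c y z, Q c (y + z) =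
      Q c y + Q c z + doubleHom (Algebra.trace (ZMod 2) K (c * (y * z))))
    {c c' : K} (hc : c ≠ c') (x x' : Fin d) :
    ‖inner ℂ (phaseVector e (Q c) x) (phaseVector e (Q c') x')‖ ^ 2 = 1 / (d : ℝ) := by
  classical
  have hcard : (Fintype.card K : ℝ) = d := by rw [Fintype.card_congr e, Fintype.card_fin]
  have hd : (d : ℝ) ≠ 0 := by
    rw [← hcard]
    exact_mod_cast Fintype.card_ne_zero
  rw [inner_phaseVector, norm_mul, mul_pow,
    norm_sq_gauss_sum _ (fun y => ((Algebra.trace (ZMod 2) K).toAddMonoidHom).comp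
      (AddMonoidHom.mulLeft ((c' - c) * y)))]
  · rw [hcard, norm_inv, Complex.norm_natCast]
    field_simp
  · intro y z
    have h1 : (AddMonoidHom.comp (Algebra.trace (ZMod 2) K).toAddMonoidHom
        (AddMonoidHom.mulLeft ((c' - c) * y))) z =
        Algebra.trace (ZMod 2) K (c' * (y * z)) - Algebra.trace (ZMod 2) K (c * (y * z)) := by
      rw [← map_sub, ← sub_mul, ← mul_assoc]; rfl
    rw [h1, hQ, hQ, mul_add, map_add, map_add, map_sub]
    ring
  · intro y hy
    exact exists_trace_mul_ne_zero (mul_ne_zero (sub_ne_zero.mpr hc.symm) hy)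
  · intro z
    simp

/-- In dimension `2 ^ a` there is a maximal MUB. -/
theorem exists_maximalMUB_two_pow {a : ℕ} (ha : a ≠ 0) :
    ∃ B : BasisFamily (2 ^ a), IsMaximalMUB B := by
  classical
  let K := GaloisField 2 a
  have : Finite K := Nat.finite_of_card_ne_zero (by rw [GaloisField.card 2 a ha]; positivity)
  let : Fintype K := Fintype.ofFinite K
  have hcard : Fintype.card K = 2 ^ a := by rw [← Nat.card_eq_fintype_card, GaloisField.card 2 a ha]
  let e : K ≃ Fin (2 ^ a) := Fintype.equivFinOfCardEq hcard
  have hQ : ∀ c : K, ∃ Q : K → ZMod 4, ∀ y z, Q (y + z) =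
      Q y + Q z + doubleHom (Algebra.trace (ZMod 2) K (c * (y * z))) := by
    intro c
    refine exists_quadratic_refinement ((Algebra.traceForm (ZMod 2) K).comp
      (LinearMap.mulLeft (ZMod 2) c) LinearMap.id) ?_ |>.imp fun Q h y z => ?_
    · intro y z
      simp only [LinearMap.BilinForm.comp_apply, Algebra.traceForm_apply, LinearMap.mulLeft_apply,
        LinearMap.id_apply]
      congr 1
      ring
    · rw [h]
      simp only [LinearMap.BilinForm.comp_apply, Algebra.traceForm_apply, LinearMap.mulLeft_apply,
        LinearMap.id_apply, mul_assoc]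
  choose Q hQ using hQ
  let o : Fin (2 ^ a + 1) ≃ Option K := Fintype.equivOfCardEq (by
    rw [Fintype.card_fin, Fintype.card_option, hcard])
  have hspan : ∀ c, ⊤ ≤ Submodule.span ℂ (Set.range (phaseVector e (Q c))) := by
    intro c
    have : Nonempty (Fin (2 ^ a)) := ⟨⟨0, by positivity⟩⟩
    have h := (basisOfOrthonormalOfCardEqFinrank (orthonormal_phaseVector e (Q c))
      (by simp)).span_eq
    rw [coe_basisOfOrthonormalOfCardEqFinrank] at h
    exact h.ge
  -- The bases are indexed by the projective line over `K`, with `none` as the point at infinity.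
  let F : Option K → OrthonormalBasis (Fin (2 ^ a)) ℂ (EuclideanSpace ℂ (Fin (2 ^ a))) := fun t =>
    t.elim (EuclideanSpace.basisFun (Fin (2 ^ a)) ℂ)
      fun c => OrthonormalBasis.mk (orthonormal_phaseVector e (Q c)) (hspan c)
  have hF : ∀ s t, s ≠ t → ∀ x y, ‖inner ℂ (F s x) (F t y)‖ ^ 2 = 1 / ((2 ^ a : ℕ) : ℝ) := by
    intro s t hst x y
    rcases s with _ | c <;> rcases t with _ | c'
    · exact absurd rfl hst
    · rw [← inner_conj_symm, RCLike.norm_conj]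
      simp only [F, Option.elim_some, Option.elim_none, OrthonormalBasis.coe_mk]
      exact norm_inner_phaseVector_basisFun e _ _ _
    · simp only [F, Option.elim_some, Option.elim_none, OrthonormalBasis.coe_mk]
      exact norm_inner_phaseVector_basisFun e _ _ _
    · simp only [F, Option.elim_some, OrthonormalBasis.coe_mk]
      exact norm_inner_phaseVector e Q hQ (fun h => hst (congrArg some h)) x y
  exact ⟨fun l => F (o l), fun l l' hl => hF _ _ fun h => hl (o.injective h)⟩

end MUBExistence

/-! ### The 2-design property and its consequences for Frobenius and trace norms -/

section TwoDesign

variable {d : ℕ}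

/-- The tensor `ψ ⊗ ψ̄ ⊗ ψ̄ ⊗ ψ`. -/
noncomputable def tensorFour (u : EuclideanSpace ℂ (Fin d)) :
    EuclideanSpace ℂ (Fin d × Fin d × Fin d × Fin d) :=
  WithLp.toLp 2 fun t => u t.1 * star (u t.2.1) * star (u t.2.2.1) * u t.2.2.2

/-- The tensor with entries `δ_ij δ_km`. -/
noncomputable def deltaParallel (d : ℕ) : EuclideanSpace ℂ (Fin d × Fin d × Fin d × Fin d) :=
  WithLp.toLp 2 fun t => (if t.1 = t.2.1 then 1 else 0) * (if t.2.2.1 = t.2.2.2 then 1 else 0)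

/-- The tensor with entries `δ_ik δ_jm`. -/
noncomputable def deltaCross (d : ℕ) : EuclideanSpace ℂ (Fin d × Fin d × Fin d × Fin d) :=
  WithLp.toLp 2 fun t => (if t.1 = t.2.2.1 then 1 else 0) * (if t.2.1 = t.2.2.2 then 1 else 0)

lemma sum_four_mul (f g h l : Fin d → ℂ) :
    ∑ i, ∑ j, ∑ k, ∑ m, f i * g j * h k * l m =
      (∑ i, f i) * (∑ j, g j) * (∑ k, h k) * ∑ m, l m := by
  simp only [← Finset.mul_sum, ← Finset.sum_mul]

lemma sum_comm_four {α : Type} [Fintype α] (f : α → Fin d → Fin d → Fin d → Fin d → ℂ) :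
    ∑ a, ∑ i, ∑ j, ∑ k, ∑ m, f a i j k m = ∑ i, ∑ j, ∑ k, ∑ m, ∑ a, f a i j k m := by
  rw [Finset.sum_comm]
  refine Finset.sum_congr rfl fun i _ => ?_
  rw [Finset.sum_comm]
  refine Finset.sum_congr rfl fun j _ => ?_
  rw [Finset.sum_comm]
  refine Finset.sum_congr rfl fun k _ => ?_
  rw [Finset.sum_comm]

lemma inner_euclidean (u w : EuclideanSpace ℂ (Fin d)) :
    inner ℂ u w = ∑ i, w i * star (u i) := by
  rw [PiLp.inner_apply]; rfl

lemma inner_four (u w : EuclideanSpace ℂ (Fin d × Fin d × Fin d × Fin d)) :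
    inner ℂ u w = ∑ i, ∑ j, ∑ k, ∑ m, w (i, j, k, m) * star (u (i, j, k, m)) := by
  rw [PiLp.inner_apply]
  simp only [Fintype.sum_prod_type]; rfl

lemma inner_tensorFour (u w : EuclideanSpace ℂ (Fin d)) :
    inner ℂ (tensorFour u) (tensorFour w) = ((‖inner ℂ u w‖ ^ 4 : ℝ) : ℂ) := by
  have h1 : inner ℂ (tensorFour u) (tensorFour w) =
      inner ℂ u w * star (inner ℂ u w) * star (inner ℂ u w) * inner ℂ u w := by
    rw [inner_four, inner_euclidean, star_sum, ← sum_four_mul]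
    refine Finset.sum_congr rfl fun i _ => Finset.sum_congr rfl fun j _ =>
      Finset.sum_congr rfl fun k _ => Finset.sum_congr rfl fun m _ => ?_
    simp only [tensorFour, star_mul', star_star]
    ring
  have h2 : inner ℂ u w * star (inner ℂ u w) = ((‖inner ℂ u w‖ ^ 2 : ℝ) : ℂ) := by
    rw [Complex.star_def, Complex.mul_conj', Complex.ofReal_pow]
  rw [h1, h2, mul_assoc, mul_comm (star _), h2, ← Complex.ofReal_mul]
  congr 1
  ring

lemma sum_mul_star_of_norm_eq_one {u : EuclideanSpace ℂ (Fin d)} (hu : ‖u‖ = 1) :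
    ∑ i, u i * star (u i) = 1 := by
  rw [← inner_euclidean, inner_self_eq_norm_sq_to_K, hu]
  simp

lemma inner_deltaParallel {u : EuclideanSpace ℂ (Fin d)} (hu : ‖u‖ = 1) :
    inner ℂ (deltaParallel d) (tensorFour u) = 1 := by
  have h : inner ℂ (deltaParallel d) (tensorFour u) =
      (∑ i, u i * star (u i)) * ∑ k, u k * star (u k) := by
    rw [inner_four, Finset.sum_mul_sum]
    refine Finset.sum_congr rfl fun i _ => ?_
    rw [Finset.sum_eq_single i]
    · refine Finset.sum_congr rfl fun k _ => ?_
      rw [Finset.sum_eq_single k]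
      · simp [deltaParallel, tensorFour]; ring
      · intro m _ hm; simp [deltaParallel, hm.symm]
      · simp
    · intro j _ hj
      simp [deltaParallel, hj.symm]
    · simp
  rw [h, sum_mul_star_of_norm_eq_one hu, one_mul]

lemma inner_deltaCross {u : EuclideanSpace ℂ (Fin d)} (hu : ‖u‖ = 1) :
    inner ℂ (deltaCross d) (tensorFour u) = 1 := by
  have h : inner ℂ (deltaCross d) (tensorFour u) =
      (∑ i, u i * star (u i)) * ∑ k, u k * star (u k) := by
    rw [inner_four, Finset.sum_mul_sum]
    refine Finset.sum_congr rfl fun i _ => Finset.sum_congr rfl fun j _ => ?_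
    rw [Finset.sum_eq_single i]
    · rw [Finset.sum_eq_single j]
      · simp [deltaCross, tensorFour]; ring
      · intro m _ hm; simp [deltaCross, hm.symm]
      · simp
    · intro k _ hk
      simp [deltaCross, hk.symm]
    · simp
  rw [h, sum_mul_star_of_norm_eq_one hu, one_mul]

lemma inner_deltaParallel_self : inner ℂ (deltaParallel d) (deltaParallel d) = (d : ℂ) ^ 2 := by
  rw [inner_four]
  simp [deltaParallel, sq]

lemma inner_deltaCross_self : inner ℂ (deltaCross d) (deltaCross d) = (d : ℂ) ^ 2 := by
  rw [inner_four]
  simp [deltaCross, sq]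

lemma inner_deltaParallel_deltaCross : inner ℂ (deltaParallel d) (deltaCross d) = (d : ℂ) := by
  rw [inner_four]
  simp [deltaParallel, deltaCross, apply_ite (starRingEnd ℂ)]

/-- The basis of the vector itself contributes 1, and each of the `d` others contributes d · (1/d)²
= 1/d. -/
lemma sum_norm_inner_pow_four {B : BasisFamily d} (hB : IsMaximalMUB B) (l : Fin (d + 1))
    (x : Fin d) : ∑ b : Fin (d + 1) × Fin d, ‖inner ℂ (B l x) (B b.1 b.2)‖ ^ 4 = 2 := by
  have hd : (d : ℝ) ≠ 0 := by
    have := x.pos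
    positivity
  rw [Fintype.sum_prod_type, ← Finset.add_sum_erase _ _ (Finset.mem_univ l)]
  have h1 : ∑ y, ‖inner ℂ (B l x) (B l y)‖ ^ 4 = 1 := by
    rw [Finset.sum_eq_single x]
    · simp
    · intro y _ hy
      rw [(B l).orthonormal.inner_eq_zero hy.symm]; simp
    · simp
  have h2 : ∀ l' ∈ Finset.univ.erase l, ∑ y, ‖inner ℂ (B l x) (B l' y)‖ ^ 4 = 1 / d := by
    intro l' hl'
    have h3 : ∀ y, ‖inner ℂ (B l x) (B l' y)‖ ^ 4 = (1 / (d : ℝ)) ^ 2 := fun y => by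
      rw [← hB l l' (Finset.ne_of_mem_erase hl').symm x y]; ring
    simp only [h3, Finset.sum_const, Finset.card_univ, Fintype.card_fin, nsmul_eq_mul]
    field_simp
  rw [h1, Finset.sum_congr rfl h2, Finset.sum_const, Finset.card_erase_of_mem (Finset.mem_univ l),
    Finset.card_univ, Fintype.card_fin, Nat.add_sub_cancel, nsmul_eq_mul]
  field_simp
  norm_num

/-- The vectors of a maximal MUB form a complex projective `2`-design. -/
theorem sum_tensorFour {B : BasisFamily d} (hB : IsMaximalMUB B) :
    ∑ a : Fin (d + 1) × Fin d, tensorFour (B a.1 a.2) = deltaParallel d + deltaCross d := by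
  have hn : ∀ a : Fin (d + 1) × Fin d, ‖B a.1 a.2‖ = 1 := fun a => (B a.1).orthonormal.1 a.2
  have hvv : inner ℂ (∑ a : Fin (d + 1) × Fin d, tensorFour (B a.1 a.2))
      (∑ a : Fin (d + 1) × Fin d, tensorFour (B a.1 a.2)) = ((d : ℂ) + 1) * d * 2 := by
    have h1 : ∀ a : Fin (d + 1) × Fin d, inner ℂ (tensorFour (B a.1 a.2))
        (∑ b : Fin (d + 1) × Fin d, tensorFour (B b.1 b.2)) = 2 := by
      intro a
      rw [inner_sum]
      simp only [inner_tensorFour]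
      rw [← Complex.ofReal_sum, sum_norm_inner_pow_four hB]
      simp
    rw [sum_inner]
    simp only [h1]
    simp
  have hpv : inner ℂ (deltaParallel d) (∑ a : Fin (d + 1) × Fin d, tensorFour (B a.1 a.2)) =
      ((d : ℂ) + 1) * d := by
    simp only [inner_sum, inner_deltaParallel (hn _)]
    simp
  have hcv : inner ℂ (deltaCross d) (∑ a : Fin (d + 1) × Fin d, tensorFour (B a.1 a.2)) =
      ((d : ℂ) + 1) * d := by
    simp only [inner_sum, inner_deltaCross (hn _)]
    simp
  have hvp : inner ℂ (∑ a : Fin (d + 1) × Fin d, tensorFour (B a.1 a.2)) (deltaParallel d) =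
      ((d : ℂ) + 1) * d := by
    rw [← inner_conj_symm, hpv]; simp
  have hvc : inner ℂ (∑ a : Fin (d + 1) × Fin d, tensorFour (B a.1 a.2)) (deltaCross d) =
      ((d : ℂ) + 1) * d := by
    rw [← inner_conj_symm, hcv]; simp
  have hcp : inner ℂ (deltaCross d) (deltaParallel d) = (d : ℂ) := by
    rw [← inner_conj_symm, inner_deltaParallel_deltaCross]; simp
  -- The squared distance between the two sides is 2d(d + 1) - 4d(d + 1) + 2d² + 2d = 0: the family
  -- attains the minimal frame potential, which forces equality.
  rw [← sub_eq_zero, ← inner_self_eq_zero (𝕜 := ℂ)]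
  simp only [inner_sub_left, inner_sub_right, inner_add_left, inner_add_right, hvv, hpv, hcv, hvp,
    hvc, hcp, inner_deltaParallel_self, inner_deltaCross_self, inner_deltaParallel_deltaCross]
  ring

lemma trace_ketbra_mul (u : EuclideanSpace ℂ (Fin d)) (A : Matrix (Fin d) (Fin d) ℂ) :
    (ketbra u * A).trace = ∑ i, ∑ j, u i * star (u j) * A j i := by
  simp only [Matrix.trace, Matrix.diag_apply, Matrix.mul_apply, ketbra, Matrix.vecMulVec_apply,
    Pi.star_apply]

/-- The squared Frobenius norm. -/
noncomputable def frobSq (A : Matrix (Fin d) (Fin d) ℂ) : ℝ := ∑ i, ∑ j, ‖A i j‖ ^ 2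

lemma frobSq_nonneg (A : Matrix (Fin d) (Fin d) ℂ) : 0 ≤ frobSq A :=
  Finset.sum_nonneg fun _ _ => Finset.sum_nonneg fun _ _ => by positivity

/-- This is the design identity contracted with A ⊗ Ā: the parallel pairing of indices gives |Tr A|²
and the crossed pairing gives the Frobenius norm. -/
lemma sum_norm_trace_ketbra_sq {B : BasisFamily d} (hB : IsMaximalMUB B)
    (A : Matrix (Fin d) (Fin d) ℂ) :
    ∑ a : Fin (d + 1) × Fin d, ‖(ketbra (B a.1 a.2) * A).trace‖ ^ 2 =
      ‖A.trace‖ ^ 2 + frobSq A := by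
  have hT : ∀ i j k m, ∑ a : Fin (d + 1) × Fin d, B a.1 a.2 i * star (B a.1 a.2 j) *
      star (B a.1 a.2 k) * B a.1 a.2 m =
      (if i = j then 1 else 0) * (if k = m then 1 else 0) +
      (if i = k then 1 else 0) * (if j = m then 1 else 0) := by
    intro i j k m
    have h := congrArg (fun v => v (i, j, k, m)) (sum_tensorFour hB)
    simpa [tensorFour, deltaParallel, deltaCross] using h
  have hexp : ∀ a : Fin (d + 1) × Fin d, (((‖(ketbra (B a.1 a.2) * A).trace‖ ^ 2 : ℝ)) : ℂ) =
      ∑ i, ∑ j, ∑ k, ∑ m, (B a.1 a.2 i * star (B a.1 a.2 j) *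
        star (B a.1 a.2 k) * B a.1 a.2 m) * (A j i * star (A m k)) := by
    intro a
    rw [Complex.ofReal_pow, ← Complex.mul_conj', ← Complex.star_def, trace_ketbra_mul, star_sum]
    simp only [star_sum, Finset.sum_mul, star_mul', star_star]
    refine Finset.sum_congr rfl fun i _ => Finset.sum_congr rfl fun j _ => ?_
    rw [Finset.mul_sum]
    refine Finset.sum_congr rfl fun k _ => ?_
    rw [Finset.mul_sum]
    refine Finset.sum_congr rfl fun m _ => ?_
    ring
  have htr : ((‖A.trace‖ ^ 2 : ℝ) : ℂ) = (∑ i, A i i) * ∑ k, star (A k k) := by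
    rw [Complex.ofReal_pow, ← Complex.mul_conj', ← Complex.star_def, Matrix.trace, star_sum]
    rfl
  have hfr : ((frobSq A : ℝ) : ℂ) = ∑ i, ∑ j, A j i * star (A j i) := by
    rw [frobSq, Finset.sum_comm, Complex.ofReal_sum]
    refine Finset.sum_congr rfl fun i _ => ?_
    rw [Complex.ofReal_sum]
    refine Finset.sum_congr rfl fun j _ => ?_
    rw [Complex.ofReal_pow, ← Complex.mul_conj', ← Complex.star_def]
  rw [← Complex.ofReal_inj, Complex.ofReal_sum, Complex.ofReal_add, htr, hfr]
  simp only [hexp]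
  rw [sum_comm_four]
  simp only [← Finset.sum_mul, hT]
  simp only [add_mul, Finset.sum_add_distrib]
  congr 1
  · rw [Finset.sum_mul_sum]
    simp [Finset.sum_ite_eq]
  · simp [Finset.sum_ite_eq]

/-- The trace norm is at most `√d` times the Frobenius norm. -/
lemma traceNorm_le (A : Matrix (Fin d) (Fin d) ℂ) :
    traceNorm A ≤ Real.sqrt d * Real.sqrt (frobSq A) := by
  have hH := Matrix.isHermitian_conjTranspose_mul_self A
  have hnn : ∀ i, 0 ≤ hH.eigenvalues i :=
    (Matrix.posSemidef_conjTranspose_mul_self A).eigenvalues_nonneg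
  have htr : ∑ i, hH.eigenvalues i = frobSq A := by
    have h := hH.trace_eq_sum_eigenvalues
    rw [← Complex.ofReal_inj, Complex.ofReal_sum]
    refine h.symm.trans ?_
    rw [frobSq, Finset.sum_comm, Complex.ofReal_sum, Matrix.trace]
    refine Finset.sum_congr rfl fun i _ => ?_
    rw [Complex.ofReal_sum, Matrix.diag_apply, Matrix.mul_apply]
    refine Finset.sum_congr rfl fun j _ => ?_
    rw [Complex.ofReal_pow, ← Complex.conj_mul', Matrix.conjTranspose_apply, Complex.star_def]
  rw [← Real.sqrt_mul (Nat.cast_nonneg d)]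
  refine Real.le_sqrt_of_sq_le ?_
  -- Cauchy–Schwarz for the `d` singular values.
  have h := sq_sum_le_card_mul_sum_sq (s := Finset.univ)
    (f := fun i => Real.sqrt (hH.eigenvalues i))
  simp only [Real.sq_sqrt (hnn _), Finset.card_univ, Fintype.card_fin] at h
  rw [← htr]
  exact h

/-- With ρ = C* C, Cauchy–Schwarz bounds |ρ_ij|² by ρ_ii ρ_jj, and these products sum to (Tr ρ)² =
1. -/
lemma frobSq_le_one (ρ : DensityMatrix d) : frobSq ρ.mat ≤ 1 := by
  obtain ⟨C, hC⟩ : ∃ C, ρ.mat = Cᴴ * C := by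
    open scoped MatrixOrder Matrix.Norms.L2Operator in
    exact CStarAlgebra.nonneg_iff_eq_star_mul_self.mp ρ.posSemidef.nonneg
  have hdiag : ∑ i, ∑ k, ‖C k i‖ ^ 2 = 1 := by
    have h := ρ.trace_eq_one
    rw [hC, Matrix.trace] at h
    rw [← Complex.ofReal_inj, Complex.ofReal_one, ← h, Complex.ofReal_sum]
    refine Finset.sum_congr rfl fun i _ => ?_
    rw [Complex.ofReal_sum, Matrix.diag_apply, Matrix.mul_apply]
    refine Finset.sum_congr rfl fun j _ => ?_
    rw [Complex.ofReal_pow, ← Complex.conj_mul', Matrix.conjTranspose_apply, Complex.star_def]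
  have hij : ∀ i j, ‖ρ.mat i j‖ ^ 2 ≤ (∑ k, ‖C k i‖ ^ 2) * ∑ k, ‖C k j‖ ^ 2 := by
    intro i j
    rw [hC, Matrix.mul_apply]
    refine le_trans ?_ (Finset.sum_mul_sq_le_sq_mul_sq _ (fun k => ‖C k i‖) fun k => ‖C k j‖)
    refine pow_le_pow_left₀ (norm_nonneg _) ((norm_sum_le _ _).trans_eq ?_) 2
    simp only [Matrix.conjTranspose_apply, norm_mul, norm_star]
  calc frobSq ρ.mat ≤ ∑ i, ∑ j, (∑ k, ‖C k i‖ ^ 2) * ∑ k, ‖C k j‖ ^ 2 :=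
        Finset.sum_le_sum fun i _ => Finset.sum_le_sum fun j _ => hij i j
    _ = 1 := by rw [← Finset.sum_mul_sum, hdiag, one_mul]

/-! ### Outcome distributions of the MUB measurement -/

lemma trace_ketbra_mul_im (u : EuclideanSpace ℂ (Fin d)) (ρ : DensityMatrix d) :
    ((ketbra u * ρ.mat).trace).im = 0 :=
  (Complex.nonneg_iff.mp (trace_mul_nonneg (Matrix.posSemidef_vecMulVec_self_star _)
    ρ.posSemidef)).2.symm

lemma trace_ketbra_mul_re_nonneg (u : EuclideanSpace ℂ (Fin d)) (ρ : DensityMatrix d) :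
    0 ≤ ((ketbra u * ρ.mat).trace).re :=
  (Complex.nonneg_iff.mp (trace_mul_nonneg (Matrix.posSemidef_vecMulVec_self_star _)
    ρ.posSemidef)).1

lemma born_mubPOVM_apply (B : BasisFamily d) (ρ : DensityMatrix d) (a : Fin d × Fin (d + 1)) :
    (born (mubPOVM B) ρ a).toReal =
      ((d : ℝ) + 1)⁻¹ * ((ketbra (B a.2 a.1) * ρ.mat).trace).re := by
  have h : ((mubPOVM B).effect a * ρ.mat).trace.re =
      ((d : ℝ) + 1)⁻¹ * ((ketbra (B a.2 a.1) * ρ.mat).trace).re := by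
    simp only [mubPOVM, Matrix.smul_mul, Matrix.trace_smul]
    rw [Complex.real_smul, Complex.re_ofReal_mul]
  change (ENNReal.ofReal (((mubPOVM B).effect a * ρ.mat).trace.re)).toReal = _
  rw [h, ENNReal.toReal_ofReal]
  exact mul_nonneg (by positivity) (trace_ketbra_mul_re_nonneg _ _)

lemma l2norm_nonneg {X : Type} [Fintype X] (v : X → ℝ) : 0 ≤ l2norm v := Real.sqrt_nonneg _

lemma l2norm_sq {X : Type} [Fintype X] (v : X → ℝ) : l2norm v ^ 2 = ∑ x, v x ^ 2 :=
  Real.sq_sqrt (Finset.sum_nonneg fun _ _ => sq_nonneg _)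

/-- `‖p_ρ - p_σ‖₂ = ‖ρ - σ‖_F / (d + 1)`. -/
lemma l2norm_sub_born_mubPOVM_sq {B : BasisFamily d} (hB : IsMaximalMUB B)
    (ρ σ : DensityMatrix d) :
    l2norm (probVec (born (mubPOVM B) ρ) - probVec (born (mubPOVM B) σ)) ^ 2 =
      frobSq (ρ.mat - σ.mat) / ((d : ℝ) + 1) ^ 2 := by
  have h := sum_norm_trace_ketbra_sq hB (ρ.mat - σ.mat)
  rw [Matrix.trace_sub, ρ.trace_eq_one, σ.trace_eq_one] at h
  simp only [sub_self, norm_zero, ne_eq, OfNat.ofNat_ne_zero, not_false_eq_true, zero_pow,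
    zero_add] at h
  rw [l2norm_sq, ← h, Finset.sum_div, ← (Equiv.prodComm _ _).sum_comp]
  refine Finset.sum_congr rfl fun a _ => ?_
  simp only [Pi.sub_apply, probVec, born_mubPOVM_apply, Equiv.prodComm_apply, Prod.snd_swap,
    Prod.fst_swap]
  rw [Matrix.mul_sub, Matrix.trace_sub, ← Complex.normSq_eq_norm_sq, Complex.normSq_apply,
    Complex.sub_im, trace_ketbra_mul_im, trace_ketbra_mul_im, Complex.sub_re]
  field_simp
  ring

lemma l2norm_born_mubPOVM_sq {B : BasisFamily d} (hB : IsMaximalMUB B) (ρ : DensityMatrix d) :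
    l2norm (probVec (born (mubPOVM B) ρ)) ^ 2 = (1 + frobSq ρ.mat) / ((d : ℝ) + 1) ^ 2 := by
  have h := sum_norm_trace_ketbra_sq hB ρ.mat
  rw [ρ.trace_eq_one, norm_one, one_pow] at h
  rw [l2norm_sq, ← h, Finset.sum_div, ← (Equiv.prodComm _ _).sum_comp]
  refine Finset.sum_congr rfl fun a _ => ?_
  simp only [probVec, born_mubPOVM_apply, Equiv.prodComm_apply, Prod.snd_swap, Prod.fst_swap]
  rw [← Complex.normSq_eq_norm_sq, Complex.normSq_apply, trace_ketbra_mul_im]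
  field_simp
  ring

/-- The purity is at most 1, and 2 ≤ (3/2)². -/
lemma l2norm_born_mubPOVM_le {B : BasisFamily d} (hB : IsMaximalMUB B) (ρ : DensityMatrix d) :
    l2norm (probVec (born (mubPOVM B) ρ)) ≤ (3 / 2) / ((d : ℝ) + 1) := by
  refine abs_le_of_sq_le_sq' ?_ (by positivity) |>.2
  rw [l2norm_born_mubPOVM_sq hB, div_pow]
  gcongr
  linarith [frobSq_le_one ρ]

/-- Needed so that the testing distance ε' is at most 2‖p_{ρ₀}‖₂, as the collision tester requires.
-/
lemma le_l2norm_born_mubPOVM {B : BasisFamily d} (hB : IsMaximalMUB B) (ρ : DensityMatrix d) :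
    1 / ((d : ℝ) + 1) ≤ l2norm (probVec (born (mubPOVM B) ρ)) := by
  refine abs_le_of_sq_le_sq' ?_ (l2norm_nonneg _) |>.2
  rw [l2norm_born_mubPOVM_sq hB, div_pow, one_pow]
  gcongr
  linarith [frobSq_nonneg ρ.mat]

lemma lt_l2norm_sub_of_lt_traceNorm {B : BasisFamily d} (hB : IsMaximalMUB B)
    (ρ σ : DensityMatrix d) {ε : ℝ} (hd : 0 < d)
    (h : ε < traceNorm (ρ.mat - σ.mat)) :
    ε / (((d : ℝ) + 1) * Real.sqrt d) <
      l2norm (probVec (born (mubPOVM B) ρ) - probVec (born (mubPOVM B) σ)) := by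
  have hd' : (0 : ℝ) < Real.sqrt d := Real.sqrt_pos.mpr (by exact_mod_cast hd)
  have h1 := h.trans_le (traceNorm_le _)
  have h2 : l2norm (probVec (born (mubPOVM B) ρ) - probVec (born (mubPOVM B) σ)) =
      Real.sqrt (frobSq (ρ.mat - σ.mat)) / ((d : ℝ) + 1) := by
    rw [← Real.sqrt_sq (l2norm_nonneg _), l2norm_sub_born_mubPOVM_sq hB, Real.sqrt_div
      (frobSq_nonneg _), Real.sqrt_sq (by positivity)]
  rw [h2, div_lt_div_iff₀ (by positivity) (by positivity)]
  have h3 : (0 : ℝ) < (d : ℝ) + 1 := by positivity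
  nlinarith

end TwoDesign

/-! ### Distributed simulation of a sample -/

section Simulation

variable {ι κ X Z : Type} [Fintype ι] [DecidableEq ι] [Fintype κ] [DecidableEq κ] [Fintype X]

/-- Some simultaneous-message protocol with players `ι` and messages in `Z` outputs `x` with
probability proportional to `p x` and fails with probability at most `f`. -/
def HasSimulation (ι X Z : Type) [Fintype ι] [DecidableEq ι] [Fintype X] (f : ℝ≥0∞) : Prop :=
  ∃ (enc : ι → X → Z) (dec : (ι → Z) → PMF (Option X)), ∀ p : PMF X,
    (∃ c, ∀ x, (prodPMF fun _ : ι => p).bind (fun y => dec fun i => enc i (y i)) (some x) =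
      c * p x) ∧
    (prodPMF fun _ : ι => p).bind (fun y => dec fun i => enc i (y i)) none ≤ f

lemma prodPMF_bind_comp {W : Type} (p : PMF X) (e : κ → ι) (he : Function.Injective e)
    (F : (κ → X) → PMF W) :
    (prodPMF fun _ : ι => p).bind (fun y => F (y ∘ e)) = (prodPMF fun _ : κ => p).bind F := by
  have h := prodPMF_map_comp (fun _ : ι => p) e he
  have h2 : (prodPMF fun _ : κ => p) = prodPMF ((fun _ : ι => p) ∘ e) := rfl
  rw [h2, ← h, PMF.bind_map]
  rfl

/-- Additional players can be ignored. -/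
lemma HasSimulation.of_injective {f : ℝ≥0∞} (h : HasSimulation κ X Z f) (z : Z) (e : κ → ι)
    (he : Function.Injective e) : HasSimulation ι X Z f := by
  obtain ⟨enc, dec, h⟩ := h
  -- Players outside the range of `e` send the constant `z`, which the server never reads.
  refine ⟨Function.extend e enc fun _ _ => z, fun y => dec (y ∘ e), fun p => ?_⟩
  have h1 : (prodPMF fun _ : ι => p).bind (fun y => dec ((fun i =>
      Function.extend e enc (fun _ _ => z) i (y i)) ∘ e)) =
      (prodPMF fun _ : κ => p).bind fun y => dec fun i => enc i (y i) := by
    rw [← prodPMF_bind_comp p e he]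
    congr 1
    funext y
    congr 1
    funext i
    simp only [Function.comp_apply, he.extend_apply]
  rw [h1]
  exact h p

lemma prodPMF_sum_bind {W : Type} (p : PMF X) (F : (ι → X) → (κ → X) → PMF W) :
    (prodPMF fun _ : ι ⊕ κ => p).bind (fun y => F (y ∘ Sum.inl) (y ∘ Sum.inr)) =
      (prodPMF fun _ : ι => p).bind fun a => (prodPMF fun _ : κ => p).bind fun b => F a b := by
  ext w
  simp only [PMF.bind_apply, tsum_fintype, prodPMF_apply]
  rw [← (Equiv.sumArrowEquivProdArrow ι κ X).symm.sum_comp, Fintype.sum_prod_type]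
  refine Finset.sum_congr rfl fun a _ => ?_
  rw [Finset.mul_sum]
  refine Finset.sum_congr rfl fun b _ => ?_
  rw [Fintype.prod_sum_type, ← mul_assoc]
  rfl

/-- If the first protocol fails, use the second one. -/
lemma HasSimulation.sum {f g : ℝ≥0∞} (h₁ : HasSimulation ι X Z f) (h₂ : HasSimulation κ X Z g) :
    HasSimulation (ι ⊕ κ) X Z (f * g) := by
  obtain ⟨enc₁, dec₁, h₁⟩ := h₁
  obtain ⟨enc₂, dec₂, h₂⟩ := h₂
  refine ⟨Sum.elim enc₁ enc₂, fun y => (dec₁ (y ∘ Sum.inl)).bind fun o =>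
    o.elim (dec₂ (y ∘ Sum.inr)) fun x => PMF.pure (some x), fun p => ?_⟩
  have hlaw : (prodPMF fun _ : ι ⊕ κ => p).bind (fun y =>
      (dec₁ ((fun i => Sum.elim enc₁ enc₂ i (y i)) ∘ Sum.inl)).bind fun o =>
        o.elim (dec₂ ((fun i => Sum.elim enc₁ enc₂ i (y i)) ∘ Sum.inr)) fun x =>
          PMF.pure (some x)) =
      ((prodPMF fun _ : ι => p).bind fun a => dec₁ fun i => enc₁ i (a i)).bind fun o =>
        o.elim ((prodPMF fun _ : κ => p).bind fun b => dec₂ fun i => enc₂ i (b i)) fun x =>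
          PMF.pure (some x) := by
    refine (prodPMF_sum_bind p fun a b => (dec₁ fun i => enc₁ i (a i)).bind fun o =>
      o.elim (dec₂ fun i => enc₂ i (b i)) fun x => PMF.pure (some x)).trans ?_
    rw [PMF.bind_bind]
    congr 1
    funext a
    rw [PMF.bind_comm]
    congr 1
    funext o
    cases o
    · rfl
    · exact PMF.bind_const _ _
  obtain ⟨⟨c, hc⟩, hf⟩ := h₁ p
  obtain ⟨⟨c', hc'⟩, hg⟩ := h₂ p
  rw [hlaw]
  constructor
  -- The output `x` arises either in the first protocol or in the second after a failure, so the
  -- proportionality constants combine to c + Pr(first fails) · c'.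
  · refine ⟨(prodPMF fun _ : ι => p).bind (fun y => dec₁ fun i => enc₁ i (y i)) none * c' + c,
      fun x => ?_⟩
    classical
    rw [PMF.bind_apply, tsum_fintype, Fintype.sum_option]
    simp only [Option.elim_none, Option.elim_some, hc', PMF.pure_apply, Option.some.injEq]
    rw [Finset.sum_eq_single x]
    · rw [hc]; simp; ring
    · intro b _ hb; simp [hb.symm]
    · simp
  · rw [PMF.bind_apply, tsum_fintype, Fintype.sum_option]
    simp only [Option.elim_none, Option.elim_some, PMF.pure_apply, reduceCtorEq, if_false,
      mul_zero, Finset.sum_const_zero, add_zero]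
    exact mul_le_mul' hf hg

lemma HasSimulation.repeat {n : ℕ} {f : ℝ≥0∞} (h : HasSimulation (Fin n) X Z f) [Nonempty Z]
    (r : ℕ) (hr : r ≠ 0) : HasSimulation (Fin (n * r)) X Z (f ^ r) := by
  obtain ⟨z⟩ := ‹Nonempty Z›
  induction r with
  | zero => exact absurd rfl hr
  | succ r ih =>
    rcases Nat.eq_zero_or_pos r with rfl | hr'
    · rwa [zero_add, pow_one, mul_one]
    · rw [pow_succ, Nat.mul_succ]
      exact ((ih hr'.ne').sum h).of_injective z finSumFinEquiv finSumFinEquiv.injective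

lemma HasSimulation.mono {f g : ℝ≥0∞} (h : HasSimulation ι X Z f) (hfg : f ≤ g) :
    HasSimulation ι X Z g := by
  obtain ⟨enc, dec, h⟩ := h
  exact ⟨enc, dec, fun p => ⟨(h p).1, (h p).2.trans hfg⟩⟩

/-- Keep a symbol with probability `1 / 2`. -/
noncomputable def thin (o : Option X) : PMF (Option X) :=
  (PMF.uniformOfFintype Bool).map fun b => if b then o else none

lemma thin_some_apply_some {X : Type} [DecidableEq X] (x a : X) :
    thin (some a) (some x) = if x = a then 2⁻¹ else 0 := by
  simp [thin, PMF.map_apply, tsum_fintype]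

lemma thin_none_apply_some {X : Type} (x : X) : thin (none : Option X) (some x) = 0 := by
  simp [thin, PMF.map_apply, tsum_fintype]

variable {m : ℕ}

/-- The thinned message about block `β`, for a sample from `p`. -/
noncomputable def blockLaw (blk : X → Fin m) (p : PMF X) (β : Fin m) : PMF (Option X) :=
  p.bind fun x => thin (if blk x = β then some x else none)

lemma blockLaw_some (blk : X → Fin m) (p : PMF X) (β : Fin m) (x : X) :
    blockLaw blk p β (some x) = if blk x = β then p x * 2⁻¹ else 0 := by
  classical
  rw [blockLaw, PMF.bind_apply, tsum_fintype, Finset.sum_eq_single x]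
  · split_ifs with h
    · rw [thin_some_apply_some, if_pos rfl]
    · rw [thin_none_apply_some, mul_zero]
  · intro a _ ha
    split_ifs
    · rw [thin_some_apply_some, if_neg ha.symm, mul_zero]
    · rw [thin_none_apply_some, mul_zero]
  · simp

/-- `x` is the only symbol reported by the first players, and the second player of its block
reports nothing. -/
def Selects (blk : X → Fin m) (y : Fin m × Bool → Option X) (x : X) : Prop :=
  y (blk x, true) = some x ∧ (∀ β, β ≠ blk x → y (β, true) = none) ∧ y (blk x, false) = none

lemma Selects.unique {X : Type} {blk : X → Fin m} {y : Fin m × Bool → Option X} {x x' : X}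
    (h : Selects blk y x) (h' : Selects blk y x') : x = x' := by
  by_cases hb : blk x = blk x'
  · have h1 := h.1
    rw [hb, h'.1] at h1
    exact (Option.some.inj h1).symm
  · have h1 := h'.2.1 _ hb
    rw [h.1] at h1
    exact absurd h1 (by simp)

open Classical in
/-- The symbol selected by the thinned messages. -/
noncomputable def selected (blk : X → Fin m) (y : Fin m × Bool → Option X) : Option X :=
  if h : ∃ x, Selects blk y x then some h.choose else none

lemma selected_eq_some {blk : X → Fin m} {y : Fin m × Bool → Option X} {x : X} :
    some x = selected blk y ↔ Selects blk y x := by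
  unfold selected
  split_ifs with h
  · rw [Option.some.injEq]
    exact ⟨fun e => e ▸ h.choose_spec, fun h' => h'.unique h.choose_spec⟩
  · simp only [false_iff]
    exact fun h' => h ⟨x, h'⟩

/-- Selecting `x` needs a report of `x`, of probability p(x)/2, together with silence of the first
players of all other blocks and of the second player of the block of `x`. The last condition
supplies the one missing factor of the product over blocks, so the coefficient of p(x) does not
depend on `x`. -/
lemma map_selected_some (blk : X → Fin m) (p : PMF X) (x : X) :
    (prodPMF fun i : Fin m × Bool => blockLaw blk p i.1).map (selected blk) (some x) =
      2⁻¹ * (∏ β, blockLaw blk p β none) * p x := by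
  classical
  rw [PMF.map_apply, tsum_fintype]
  have hsum := Finset.sum_filter (s := Finset.univ) (fun y => some x = selected blk y)
    (prodPMF fun i : Fin m × Bool => blockLaw blk p i.1)
  have hset : (Finset.univ.filter fun y : Fin m × Bool → Option X => some x = selected blk y) =
      Fintype.piFinset fun i => if i.1 = blk x then (if i.2 then {some x} else {none}) else
        (if i.2 then {none} else Finset.univ) := by
    ext y
    simp only [Finset.mem_filter, Finset.mem_univ, true_and, Fintype.mem_piFinset,
      selected_eq_some]
    constructor
    · rintro ⟨h1, h2, h3⟩ ⟨β, s⟩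
      by_cases hβ : β = blk x <;> cases s <;> simp_all
    · intro h
      refine ⟨by simpa using h (blk x, true), fun β hβ => by simpa [hβ] using h (β, true),
        by simpa using h (blk x, false)⟩
  rw [hset, sum_piFinset_prodPMF, Fintype.prod_prod_type] at hsum
  refine Eq.trans (Finset.sum_congr rfl fun y _ => ?_) (hsum.symm.trans ?_)
  · congr
  have hβ : ∀ β, ∏ s : Bool, ∑ a ∈ (if β = blk x then (if s then {some x} else {none}) else
        (if s then {none} else Finset.univ) : Finset (Option X)), blockLaw blk p β a =
      (if β = blk x then p x * 2⁻¹ else 1) * blockLaw blk p β none := by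
    intro β
    rw [Fintype.prod_bool]
    by_cases h : β = blk x
    · simp [blockLaw_some, h]
    · simp [h, pmf_sum_eq_one]
  simp only [hβ]
  rw [Finset.prod_mul_distrib, Finset.prod_ite_eq' Finset.univ (blk x), if_pos (Finset.mem_univ _)]
  ring

/-- Weierstrass' product inequality; the two additional bounds carry the induction. -/
lemma one_sub_sum_le_prod {α : Type} (s : Finset α) (a : α → ℝ) (h0 : ∀ i, 0 ≤ a i)
    (h1 : ∀ i, a i ≤ 1) : 1 - ∑ i ∈ s, a i ≤ ∏ i ∈ s, (1 - a i) ∧ 0 ≤ ∏ i ∈ s, (1 - a i) ∧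
      ∏ i ∈ s, (1 - a i) ≤ 1 := by
  classical
  induction s using Finset.induction_on with
  | empty => simp
  | insert i s hi ih =>
    rw [Finset.sum_insert hi, Finset.prod_insert hi]
    obtain ⟨h2, h3, h4⟩ := ih
    have := h0 i
    have := h1 i
    refine ⟨by nlinarith, mul_nonneg (by linarith) h3, by nlinarith⟩

/-- Thinning makes the report probabilities of the blocks sum to 1/2, and the product inequality
applies. Without thinning, a law concentrated on one block would make the product vanish. -/
lemma half_le_prod_blockLaw_none (blk : X → Fin m) (p : PMF X) :
    2⁻¹ ≤ ∏ β, blockLaw blk p β none := by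
  classical
  let a : Fin m → ℝ := fun β => ∑ x, (blockLaw blk p β (some x)).toReal
  have hsum : ∀ β, (blockLaw blk p β none).toReal = 1 - a β := fun β => by
    have h := sum_toReal_eq_one (blockLaw blk p β)
    rw [Fintype.sum_option] at h
    linarith
  have ha0 : ∀ β, 0 ≤ a β := fun β => Finset.sum_nonneg fun _ _ => ENNReal.toReal_nonneg
  have ha1 : ∀ β, a β ≤ 1 := fun β => by
    have h : 0 ≤ (blockLaw blk p β none).toReal := ENNReal.toReal_nonneg
    rw [hsum] at h
    linarith
  have hasum : ∑ β, a β = 2⁻¹ := by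
    simp only [a, blockLaw_some]
    rw [Finset.sum_comm]
    have h1 : ∀ x, ∑ β, (if blk x = β then p x * 2⁻¹ else 0 : ℝ≥0∞).toReal =
        (p x).toReal * 2⁻¹ := by
      intro x
      rw [Finset.sum_eq_single (blk x)]
      · simp
      · intro β _ hβ; simp [hβ.symm]
      · simp
    simp only [h1, ← Finset.sum_mul, sum_toReal_eq_one, one_mul]
  have h := (one_sub_sum_le_prod Finset.univ a ha0 ha1).1
  have h2 : (∏ β, blockLaw blk p β none).toReal = ∏ β, (1 - a β) := by
    rw [ENNReal.toReal_prod]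
    exact Finset.prod_congr rfl fun β _ => hsum β
  have hne : ∏ β, blockLaw blk p β none ≠ ∞ :=
    ENNReal.prod_ne_top fun β _ => (blockLaw blk p β).apply_ne_top none
  rw [← ENNReal.ofReal_toReal hne, h2]
  have h3 : (2⁻¹ : ℝ≥0∞) = ENNReal.ofReal 2⁻¹ := by
    rw [ENNReal.ofReal_inv_of_pos (by norm_num)]; simp
  rw [h3]
  refine ENNReal.ofReal_le_ofReal ?_
  rw [hasum] at h
  linarith

/-- A protocol in which two players watch each of `m` blocks of symbols. -/
lemma hasSimulation_blocks (blk : X → Fin m) (idx : X → Z) (z : Z)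
    (hinj : ∀ x x', blk x = blk x' → idx x = idx x' → x = x') (hz : ∀ x, idx x ≠ z) :
    HasSimulation (Fin m × Bool) X Z (ENNReal.ofReal (3 / 4)) := by
  classical
  let decode : Fin m → Z → Option X := fun β w =>
    if h : ∃ x, blk x = β ∧ idx x = w then some h.choose else none
  let enc : Fin m × Bool → X → Z := fun i x => if blk x = i.1 then idx x else z
  have hdec : ∀ i x, decode i.1 (enc i x) = if blk x = i.1 then some x else none := by
    intro i x
    by_cases h : blk x = i.1
    · have hex : ∃ x', blk x' = i.1 ∧ idx x' = idx x := ⟨x, h, rfl⟩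
      simp only [decode, enc, if_pos h, dif_pos hex]
      exact congrArg some (hinj _ _ (hex.choose_spec.1.trans h.symm) hex.choose_spec.2)
    · simp only [decode, enc, if_neg h]
      rw [dif_neg]
      rintro ⟨x', -, hx'⟩
      exact hz x' hx'
  -- The thinning is done by the server with its private randomness, so the encoders stay
  -- deterministic.
  refine ⟨enc, fun y => (prodPMF fun i : Fin m × Bool => thin (decode i.1 (y i))).map
    (selected blk), fun p => ?_⟩
  have hlaw : (prodPMF fun _ : Fin m × Bool => p).bind (fun y =>
      (prodPMF fun i : Fin m × Bool => thin (decode i.1 (enc i (y i)))).map (selected blk)) =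
      (prodPMF fun i : Fin m × Bool => blockLaw blk p i.1).map (selected blk) := by
    have h := prodPMF_bind (fun _ : Fin m × Bool => p) fun i x => thin (decode i.1 (enc i x))
    rw [← PMF.map_bind, h]
    simp only [hdec]
    rfl
  rw [hlaw]
  refine ⟨⟨_, map_selected_some blk p⟩, ?_⟩
  have h1 := pmf_sum_eq_one
    ((prodPMF fun i : Fin m × Bool => blockLaw blk p i.1).map (selected blk))
  rw [Fintype.sum_option] at h1
  simp only [map_selected_some, ← Finset.mul_sum, pmf_sum_eq_one, mul_one] at h1
  -- The success probability of a round is 1/2 times the product of silence probabilities, hence at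
  -- least 1/4.
  have h2 : ENNReal.ofReal (1 / 4) ≤ 2⁻¹ * ∏ β, blockLaw blk p β none := by
    refine le_trans (le_of_eq ?_) (mul_le_mul_right (half_le_prod_blockLaw_none blk p) _)
    rw [← ENNReal.mul_inv (by simp) (by simp), one_div, ENNReal.ofReal_inv_of_pos (by norm_num)]
    norm_num
  have h3 : ENNReal.ofReal (1 / 4) + ENNReal.ofReal (3 / 4) = 1 := by
    rw [← ENNReal.ofReal_add (by norm_num) (by norm_num)]; norm_num
  rw [← ENNReal.add_le_add_iff_left (a := ENNReal.ofReal (1 / 4)) ENNReal.ofReal_ne_top, h3, ← h1,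
    add_comm]
  gcongr

/-- Summing over all symbols identifies the proportionality constant with the success probability,
so conditioning on success gives exactly `p`. -/
lemma exists_simulates_of_hasSimulation {d k M : ℕ} {η : ℝ} (hη : η < 1)
    (h : HasSimulation (Fin M) (Fin d) (Fin k) (ENNReal.ofReal η)) :
    ∃ S : SimProtocol d k M, S.Simulates η := by
  obtain ⟨enc, dec, h⟩ := h
  refine ⟨⟨enc, dec⟩, fun p => ?_⟩
  obtain ⟨⟨c, hc⟩, hf⟩ := h p
  set q := SimProtocol.output ⟨enc, dec⟩ p with hq
  change q none ≤ _ at hf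
  change ∀ x, q (some x) = _ at hc
  refine ⟨hf, fun x => ?_⟩
  have hs := pmf_sum_eq_one q
  rw [Fintype.sum_option] at hs
  simp only [hc, ← Finset.mul_sum, pmf_sum_eq_one, mul_one] at hs
  have hc1 : 1 - q none = c := by
    rw [← hs]
    exact ENNReal.add_sub_cancel_left (q.apply_ne_top none)
  have hlt : q none < 1 := hf.trans_lt (by simpa using hη)
  rw [hc1, hc, mul_comm, ENNReal.mul_div_cancel_right]
  · rw [← hc1]; exact (tsub_pos_of_lt hlt).ne'
  · rw [← hc1]; exact (tsub_le_self.trans_lt ENNReal.one_lt_top).ne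

lemma one_le_ceil_logb : 1 ≤ ⌈Real.logb 2 (1 / 0.01)⌉₊ :=
  Nat.one_le_ceil_iff.mpr (Real.logb_pos (by norm_num) (by norm_num))

theorem exists_simulates {d k : ℕ} (hk : 2 ≤ k) :
    ∃ S : SimProtocol d k (numPlayers d k), S.Simulates 0.01 := by
  refine exists_simulates_of_hasSimulation (by norm_num) ?_
  set c := ⌈Real.logb 2 (1 / 0.01)⌉₊ with hc
  have hc1 : 1 ≤ c := one_le_ceil_logb
  set m := ⌈(d : ℝ) / ((k : ℝ) - 1)⌉₊ with hm
  have hk1 : 0 < k - 1 := by omega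
  have hdm : d ≤ m * (k - 1) := by
    have h := Nat.le_ceil ((d : ℝ) / ((k : ℝ) - 1))
    have hk' : ((k - 1 : ℕ) : ℝ) = (k : ℝ) - 1 := by
      rw [Nat.cast_sub (by omega), Nat.cast_one]
    rw [← hm, ← hk', div_le_iff₀ (by exact_mod_cast hk1)] at h
    exact_mod_cast h
  have h1 : HasSimulation (Fin m × Bool) (Fin d) (Fin k) (ENNReal.ofReal (3 / 4)) := by
    -- Blocks consist of `k - 1` consecutive symbols. The shift by one in the index reserves message
    -- 0 for silence.
    refine hasSimulation_blocks
      (fun x => ⟨x / (k - 1), (Nat.div_lt_iff_lt_mul hk1).mpr (x.2.trans_le hdm)⟩)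
      (fun x => ⟨x % (k - 1) + 1, by have := Nat.mod_lt x hk1; omega⟩) ⟨0, by omega⟩ ?_ ?_
    · intro x x' hq hr
      simp only [Fin.mk.injEq, Nat.add_right_cancel_iff] at hq hr
      refine Fin.ext ?_
      rw [← Nat.div_add_mod x (k - 1), hq, hr, Nat.div_add_mod]
    · intro x
      simp
  have z : Fin k := ⟨0, by omega⟩
  have hne : Nonempty (Fin k) := ⟨z⟩
  have h2 : HasSimulation (Fin (m * 2)) (Fin d) (Fin k) (ENNReal.ofReal (3 / 4)) :=
    h1.of_injective z (Fintype.equivFinOfCardEq (by simp) : Fin m × Bool ≃ Fin (m * 2))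
      (Equiv.injective _)
  -- One round uses `2m` players, so `20c` rounds use exactly the prescribed `40cm`.
  have h3 := h2.repeat (20 * c) (by omega)
  have hM : numPlayers d k = m * 2 * (20 * c) := by
    rw [numPlayers, ← hc, ← hm]; ring
  rw [hM]
  refine h3.mono ?_
  rw [← ENNReal.ofReal_pow (by norm_num)]
  refine ENNReal.ofReal_le_ofReal ?_
  -- Only `c ≥ 1` is needed, since (3/4)^20 < 0.004.
  calc (3 / 4 : ℝ) ^ (20 * c) ≤ (3 / 4) ^ 20 :=
        pow_le_pow_of_le_one (by norm_num) (by norm_num) (by omega)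
    _ ≤ 0.01 := by norm_num

end Simulation

/-! ### An ℓ₂ identity tester from collisions -/

section Tester

variable {X : Type} [Fintype X]

lemma sum_ofFn_map {X : Type} {N : ℕ} (x : Fin N → X) (f : X → ℝ) :
    (((List.ofFn x : List X) : Multiset X).map f).sum = ∑ i, f (x i) := by
  rw [Multiset.map_coe, Multiset.sum_coe, List.map_ofFn, List.sum_ofFn]
  rfl

/-- The sum of a kernel over all ordered pairs of distinct samples. -/
noncomputable def pairSum {X : Type} (K : X → X → ℝ) {N : ℕ} (x : Fin N → X) : ℝ :=
  ∑ i, ∑ j, K (x i) (x j) - ∑ i, K (x i) (x i)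

lemma pairSum_cons {X : Type} {K : X → X → ℝ} (hK : ∀ x y, K x y = K y x) {N : ℕ} (a : X) (x : Fin N → X) :
    pairSum K (Fin.cons a x : Fin (N + 1) → X) = pairSum K x + 2 * ∑ i, K a (x i) := by
  simp only [pairSum, Fin.sum_univ_succ, Fin.cons_zero, Fin.cons_succ, Finset.sum_add_distrib,
    fun i => hK (x i) a]
  ring

/-- The variance of a degenerate `U`-statistic. -/
lemma expect_pairSum_sq (p : PMF X) {g : X → X → ℝ} (hg : ∀ x y, g x y = g y x)
    (h0 : ∀ y, expect p (g y) = 0) (N : ℕ) :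
    expect (prodPMF fun _ : Fin N => p) (fun x => pairSum g x ^ 2) =
      2 * N * (N - 1) * expect p fun a => expect p fun y => g a y ^ 2 := by
  induction N with
  | zero => simp [pairSum, expect_const]
  | succ N ih =>
    have h1 : ∀ a, expect (prodPMF fun _ : Fin N => p)
        (fun x => pairSum g (Fin.cons a x : Fin (N + 1) → X) ^ 2) =
        expect (prodPMF fun _ : Fin N => p) (fun x => pairSum g x ^ 2) +
        (4 * expect (prodPMF fun _ : Fin N => p) (fun x => pairSum g x * ∑ i, g a (x i)) +
        4 * (N * expect p fun y => g a y ^ 2)) := by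
      intro a
      have h2 := expect_sum_sq (fun _ : Fin N => p) Finset.univ (fun _ y => g a y)
        fun _ _ => h0 a
      rw [Finset.sum_const, Finset.card_univ, Fintype.card_fin, nsmul_eq_mul] at h2
      rw [← h2, ← expect_mul_left, ← expect_mul_left, ← expect_add, ← expect_add]
      congr 1
      funext x
      rw [pairSum_cons hg]
      ring
    -- Given the earlier samples, the kernel is centred in the new one, so the cross term vanishes
    -- and the variance grows additively.
    have h3 : expect p (fun a => expect (prodPMF fun _ : Fin N => p)
        fun x => pairSum g x * ∑ i, g a (x i)) = 0 := by
      rw [expect_comm]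
      have h4 : ∀ x : Fin N → X, expect p (fun a => pairSum g x * ∑ i, g a (x i)) = 0 := by
        intro x
        rw [expect_mul_left, expect_sum]
        simp only [fun a i => hg a (x i), h0]
        simp
      simp only [h4, expect_const]
    rw [expect_prodPMF_succ]
    simp only [h1]
    rw [expect_add, expect_const, expect_add, expect_mul_left, expect_mul_left, expect_mul_left,
      h3, ih]
    push_cast
    ring

lemma le_l2norm (v : X → ℝ) (x : X) : v x ≤ l2norm v :=
  Real.le_sqrt_of_sq_le (Finset.single_le_sum (f := fun x => v x ^ 2)
    (fun _ _ => sq_nonneg _) (Finset.mem_univ x))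

lemma probVec_nonneg {X : Type} (p : PMF X) (x : X) : 0 ≤ probVec p x := ENNReal.toReal_nonneg

lemma sum_probVec (p : PMF X) : ∑ x, probVec p x = 1 := sum_toReal_eq_one p

lemma expect_eq_sum_probVec (p : PMF X) (f : X → ℝ) : expect p f = ∑ x, probVec p x * f x := rfl

lemma l2norm_probVec_le_one (p : PMF X) : l2norm (probVec p) ≤ 1 := by
  refine abs_le_of_sq_le_sq' ?_ zero_le_one |>.2
  rw [l2norm_sq, one_pow, ← sum_probVec p]
  refine Finset.sum_le_sum fun x _ => ?_
  rw [sq]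
  exact mul_le_of_le_one_left (probVec_nonneg p x) (toReal_apply_le_one p x)

lemma l2norm_probVec_sq_le (p q : PMF X) : l2norm (probVec p) ^ 2 ≤
    2 * l2norm (probVec q) ^ 2 + 2 * l2norm (probVec p - probVec q) ^ 2 := by
  simp only [l2norm_sq, Finset.mul_sum, ← Finset.sum_add_distrib]
  refine Finset.sum_le_sum fun x _ => ?_
  rw [Pi.sub_apply]
  nlinarith [sq_nonneg (probVec p x - 2 * probVec q x)]

/-- Pointwise p = q + (p - q), and each summand is at most its ℓ₂ norm. -/
lemma expect_sub_sq_le (p q : PMF X) :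
    expect p (fun x => (probVec p - probVec q) x ^ 2) ≤
      (l2norm (probVec q) + l2norm (probVec p - probVec q)) *
        l2norm (probVec p - probVec q) ^ 2 := by
  rw [l2norm_sq (probVec p - probVec q), expect_eq_sum_probVec, Finset.mul_sum]
  refine Finset.sum_le_sum fun x _ => mul_le_mul_of_nonneg_right ?_ (sq_nonneg _)
  have h1 := le_l2norm (probVec q) x
  have h2 := le_l2norm (probVec p - probVec q) x
  rw [Pi.sub_apply] at h2
  linarith

variable [DecidableEq X]

/-- The kernel `⟨e_x - u, e_y - u⟩`. -/
noncomputable def collisionKernel (u : X → ℝ) (x y : X) : ℝ :=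
  (if x = y then 1 else 0) - u x - u y + ∑ z, u z ^ 2

lemma collisionKernel_comm (u : X → ℝ) (x y : X) :
    collisionKernel u x y = collisionKernel u y x := by
  simp only [collisionKernel, eq_comm (a := x)]
  ring

/-- Degeneracy: e_y - p has mean zero when y is drawn from `p`. -/
lemma expect_collisionKernel (p : PMF X) (x : X) :
    expect p (collisionKernel (probVec p) x) = 0 := by
  have h : expect p (collisionKernel (probVec p) x) =
      ∑ y, ((if x = y then probVec p y else 0) - probVec p x * probVec p y - probVec p y ^ 2 +
        probVec p y * ∑ z, probVec p z ^ 2) := by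
    rw [expect_eq_sum_probVec]
    refine Finset.sum_congr rfl fun y _ => ?_
    simp only [collisionKernel]
    split_ifs <;> ring
  rw [h, Finset.sum_add_distrib, Finset.sum_sub_distrib, Finset.sum_sub_distrib,
    ← Finset.mul_sum, ← Finset.sum_mul, sum_probVec, Finset.sum_ite_eq,
    if_pos (Finset.mem_univ x)]
  ring

/-- With s = Σ p² and S = Σ p³, the second moment equals s - 2S + s², and s² ≤ S. -/
lemma expect_collisionKernel_sq_le (p : PMF X) :
    (expect p fun x => expect p fun y => collisionKernel (probVec p) x y ^ 2) ≤
      l2norm (probVec p) ^ 2 := by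
  set s := l2norm (probVec p) ^ 2 with hs
  set S := ∑ z, probVec p z ^ 3 with hS
  have hs' : ∑ z, probVec p z ^ 2 = s := by rw [hs, l2norm_sq]
  have h1 : ∀ x, expect p (fun y => collisionKernel (probVec p) x y ^ 2) =
      probVec p x - 3 * probVec p x ^ 2 + 2 * s * probVec p x + S - s ^ 2 := by
    intro x
    have h2 : expect p (fun y => collisionKernel (probVec p) x y ^ 2) =
        ∑ y, ((if x = y then probVec p y * (1 - 2 * probVec p x - 2 * probVec p y + 2 * s) else 0) +
          (probVec p x ^ 2 - 2 * s * probVec p x + s ^ 2) * probVec p y +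
          (2 * probVec p x - 2 * s) * probVec p y ^ 2 + probVec p y ^ 3) := by
      rw [expect_eq_sum_probVec]
      refine Finset.sum_congr rfl fun y _ => ?_
      simp only [collisionKernel, hs']
      split_ifs <;> ring
    rw [h2, Finset.sum_add_distrib, Finset.sum_add_distrib, Finset.sum_add_distrib,
      ← Finset.mul_sum, ← Finset.mul_sum, sum_probVec, hs', Finset.sum_ite_eq,
      if_pos (Finset.mem_univ x)]
    ring
  -- The variance of p(X) for X drawn from `p` is nonnegative.
  have h3 : s ^ 2 ≤ S := by
    have h4 : 0 ≤ expect p fun x => (probVec p x - s) ^ 2 := expect_nonneg p fun x => sq_nonneg _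
    have h5 : expect p (fun x => (probVec p x - s) ^ 2) =
        ∑ x, (probVec p x ^ 3 - 2 * s * probVec p x ^ 2 + s ^ 2 * probVec p x) :=
      (expect_eq_sum_probVec p _).trans (Finset.sum_congr rfl fun x _ => by ring)
    rw [h5, Finset.sum_add_distrib, Finset.sum_sub_distrib, ← Finset.mul_sum, ← Finset.mul_sum,
      sum_probVec, hs', ← hS] at h4
    linarith
  have h6 : (expect p fun x => expect p fun y => collisionKernel (probVec p) x y ^ 2) =
      ∑ x, (probVec p x ^ 2 - 3 * probVec p x ^ 3 + 2 * s * probVec p x ^ 2 +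
        (S - s ^ 2) * probVec p x) := by
    simp only [h1]
    rw [expect_eq_sum_probVec]
    exact Finset.sum_congr rfl fun x _ => by ring
  rw [h6, Finset.sum_add_distrib, Finset.sum_add_distrib, Finset.sum_sub_distrib,
    ← Finset.mul_sum, ← Finset.mul_sum, ← Finset.mul_sum, sum_probVec, hs', ← hS]
  linarith [sq_nonneg s]

/-- The Hoeffding decomposition of the kernel, for v = p - q: a degenerate part, two centred linear
parts and the mean ‖v‖₂². -/
lemma collisionKernel_eq (p v : X → ℝ) (x y : X) :
    collisionKernel (p - v) x y = collisionKernel p x y + (v x - ∑ z, p z * v z) +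
      (v y - ∑ z, p z * v z) + ∑ z, v z ^ 2 := by
  have h : ∑ z, (p - v) z ^ 2 = ∑ z, p z ^ 2 - 2 * ∑ z, p z * v z + ∑ z, v z ^ 2 := by
    rw [Finset.mul_sum, ← Finset.sum_sub_distrib, ← Finset.sum_add_distrib]
    exact Finset.sum_congr rfl fun z _ => by rw [Pi.sub_apply]; ring
  rw [collisionKernel, h, collisionKernel]
  simp only [Pi.sub_apply]
  ring

lemma pairSum_collisionKernel (p v : X → ℝ) {N : ℕ} (x : Fin N → X) :
    pairSum (collisionKernel (p - v)) x = pairSum (collisionKernel p) x +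
      2 * (N - 1) * ∑ i, (v (x i) - ∑ z, p z * v z) + N * (N - 1) * ∑ z, v z ^ 2 := by
  simp only [pairSum, collisionKernel_eq p v, Finset.sum_add_distrib, Finset.sum_const,
    Finset.card_univ, Fintype.card_fin, nsmul_eq_mul, ← Finset.mul_sum]
  ring

/-- The statistic of the tester is close to `N (N - 1) ‖p - q‖₂²`. -/
lemma expect_pairSum_sub_sq_le (p q : PMF X) {N : ℕ} (hN : 1 ≤ N) :
    expect (prodPMF fun _ : Fin N => p) (fun x => (pairSum (collisionKernel (probVec q)) x -
        N * (N - 1) * l2norm (probVec p - probVec q) ^ 2) ^ 2) ≤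
      4 * N * (N - 1) * l2norm (probVec p) ^ 2 +
        8 * N * (N - 1) ^ 2 * expect p fun x => (probVec p - probVec q) x ^ 2 := by
  set v := probVec p - probVec q with hv
  have hN' : (1 : ℝ) ≤ N := by exact_mod_cast hN
  have hq : probVec q = probVec p - v := by rw [hv]; abel
  set μ := ∑ z, probVec p z * v z with hμ
  have hh : expect p (fun x => v x - μ) = 0 := by
    rw [expect_sub, expect_const, expect_eq_sum_probVec, sub_self]
  have hL := expect_sum_sq (fun _ : Fin N => p) Finset.univ (fun _ x => v x - μ) fun _ _ => hh
  have hvar : expect p (fun x => (v x - μ) ^ 2) ≤ expect p fun x => v x ^ 2 := by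
    have h1 : expect p (fun x => (v x - μ) ^ 2) = expect p (fun x => v x ^ 2) - μ ^ 2 := by
      have h2 : ∀ x, (v x - μ) ^ 2 = v x ^ 2 - (2 * μ * (v x - μ) + μ ^ 2) := fun x => by ring
      simp only [h2]
      rw [expect_sub, expect_add, expect_mul_left, hh, expect_const]
      ring
    rw [h1]
    linarith [sq_nonneg μ]
  rw [Finset.sum_const, Finset.card_univ, Fintype.card_fin, nsmul_eq_mul] at hL
  have hW := expect_pairSum_sq p (collisionKernel_comm (probVec p)) (expect_collisionKernel p) N
  have hg := expect_collisionKernel_sq_le p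
  calc expect (prodPMF fun _ : Fin N => p) (fun x => (pairSum (collisionKernel (probVec q)) x -
        N * (N - 1) * l2norm v ^ 2) ^ 2)
      ≤ expect (prodPMF fun _ : Fin N => p) (fun x =>
          -- (a + b)² ≤ 2a² + 2b² separates the degenerate part from the linear part.
          2 * pairSum (collisionKernel (probVec p)) x ^ 2 +
          8 * (N - 1) ^ 2 * (∑ i, (v (x i) - μ)) ^ 2) := by
        refine expect_mono _ fun x => ?_
        rw [hq, pairSum_collisionKernel, l2norm_sq, ← hμ]
        nlinarith [sq_nonneg (pairSum (collisionKernel (probVec p)) x -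
          2 * (N - 1) * ∑ i, (v (x i) - μ))]
    _ = 2 * (2 * N * (N - 1) * expect p fun x => expect p fun y =>
          collisionKernel (probVec p) x y ^ 2) +
        8 * (N - 1) ^ 2 * (N * expect p fun x => (v x - μ) ^ 2) := by
        rw [expect_add, expect_mul_left, expect_mul_left, hW, hL]
    _ ≤ 2 * (2 * N * (N - 1) * l2norm (probVec p) ^ 2) +
        8 * (N - 1) ^ 2 * (N * expect p fun x => v x ^ 2) := by
        gcongr
    _ = _ := by ring

open Classical in
/-- The tester: reject if the sample is too small, and compare the number of collisions with a
threshold otherwise. -/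
noncomputable def collisionTester (q : PMF X) (ε : ℝ) (s : Multiset X) : PMF Bool :=
  PMF.pure (decide (1000 * l2norm (probVec q) * Real.log 6 / ε ^ 2 ≤ s.card ∧
    (s.map fun x => (s.map (collisionKernel (probVec q) x)).sum).sum -
      (s.map fun x => collisionKernel (probVec q) x x).sum ≤
        s.card * (s.card - 1) * (ε ^ 2 / 2)))

open Classical in
lemma collisionTester_ofFn (q : PMF X) (ε : ℝ) {N : ℕ} (x : Fin N → X) :
    collisionTester q ε (List.ofFn x : Multiset X) =
      PMF.pure (decide (1000 * l2norm (probVec q) * Real.log 6 / ε ^ 2 ≤ N ∧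
        pairSum (collisionKernel (probVec q)) x ≤ N * (N - 1) * (ε ^ 2 / 2))) := by
  rw [collisionTester]
  simp only [sum_ofFn_map, pairSum, Multiset.coe_card, List.length_ofFn]
  congr

lemma ofReal_le_iidSamples_bind {X : Type} [Fintype X] (p : PMF X) (N : ℕ) (T : Multiset X → PMF Bool) (b : Bool)
    {r : ℝ} : ENNReal.ofReal r ≤ (iidSamples p N).bind T b ↔
      r ≤ expect (prodPMF fun _ : Fin N => p)
        fun x => (T (List.ofFn x : Multiset X) b).toReal := by
  rw [iidSamples, PMF.bind_map, ENNReal.ofReal_le_iff_le_toReal (PMF.apply_ne_top _ _),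
    toReal_bind_apply]
  rfl

lemma one_le_log_six : 1 ≤ Real.log 6 := by
  rw [Real.le_log_iff_exp_le (by norm_num)]
  linarith [Real.exp_one_lt_d9]

/-- Since N(N - 1) ≥ N²/2, the quotient is at most 32 Q²/(N²ε⁴), and NQ-size samples make this at
most 32/10⁶. -/
lemma null_variance_bound {Q ε N : ℝ} (hN : 2 ≤ N) (hNQ : 1000 * Q ≤ N * ε ^ 2)
    (hQ : 0 ≤ Q) (hε : 0 < ε) :
    4 * N * (N - 1) * Q ^ 2 / (N * (N - 1) * (ε ^ 2 / 2)) ^ 2 ≤ 1 / 6 := by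
  have hM : N / 2 ≤ N - 1 := by linarith
  have h1 : 0 < N * (N - 1) := mul_pos (by linarith) (by linarith)
  rw [div_le_iff₀ (by positivity)]
  have h2 : (1000 * Q) ^ 2 ≤ (N * ε ^ 2) ^ 2 := pow_le_pow_left₀ (by positivity) hNQ 2
  have h3 : N ^ 2 * ε ^ 4 ≤ 2 * (N * (N - 1)) * ε ^ 4 :=
    mul_le_mul_of_nonneg_right (by nlinarith) (by positivity)
  have h4 : 96 * Q ^ 2 ≤ N * (N - 1) * ε ^ 4 := by nlinarith [sq_nonneg Q]
  nlinarith [mul_le_mul_of_nonneg_left h4 h1.le]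

/-- `P` stands for ‖p‖₂² and `V` for the second moment of p - q under `p`. The condition `ε ≤ 2 * Q`
turns the sample bound into Nε ≥ 500, which controls the terms with `D` alone; the numerator is then
at most 0.028 (N(N - 1))² D⁴, below the allowed 1/24 of the same quantity. -/
lemma far_variance_bound {Q D ε N P V : ℝ} (hN : 2 ≤ N) (hNQ : 1000 * Q ≤ N * ε ^ 2)
    (hεQ : ε ≤ 2 * Q) (hε : 0 < ε) (hD : ε < D) (hP : P ≤ 2 * Q ^ 2 + 2 * D ^ 2)
    (hV : V ≤ (Q + D) * D ^ 2) :
    (4 * N * (N - 1) * P + 8 * N * (N - 1) ^ 2 * V) / (N * (N - 1) * (D ^ 2 / 2)) ^ 2 ≤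
      1 / 6 := by
  have hD0 : 0 < D := hε.trans hD
  have hN1 : 0 < N - 1 := by linarith
  have hQ : 0 < Q := by linarith
  have hQD : 1000 * Q ≤ N * D ^ 2 := hNQ.trans (by gcongr)
  have hND : 500 ≤ N * D := by
    have h1 : 500 * ε ≤ (N * ε) * ε := by nlinarith
    have h2 : 500 ≤ N * ε := le_of_mul_le_mul_right h1 hε
    exact h2.trans (by gcongr)
  have h1 : 0 < N * (N - 1) := mul_pos (by linarith) (by linarith)
  rw [div_le_iff₀ (by positivity)]
  have hP' : P ≤ N * (N - 1) * D ^ 4 * (1 / 1000) := by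
    have e1 : (1000 * Q) ^ 2 ≤ (N * D ^ 2) ^ 2 := pow_le_pow_left₀ (by positivity) hQD 2
    have e2 : 500 ^ 2 * D ^ 2 ≤ (N * D) ^ 2 * D ^ 2 :=
      mul_le_mul_of_nonneg_right (pow_le_pow_left₀ (by norm_num) hND 2) (by positivity)
    have e3 : N ^ 2 * D ^ 4 ≤ 2 * (N * (N - 1)) * D ^ 4 :=
      mul_le_mul_of_nonneg_right (by nlinarith) (by positivity)
    nlinarith
  have hV' : V ≤ N * D ^ 4 * (3 / 1000) := by
    have e1 : 1000 * Q * D ^ 2 ≤ N * D ^ 2 * D ^ 2 := by gcongr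
    have e2 : 500 * D ^ 3 ≤ N * D * D ^ 3 := by gcongr
    nlinarith
  calc 4 * N * (N - 1) * P + 8 * N * (N - 1) ^ 2 * V
      ≤ 4 * N * (N - 1) * (N * (N - 1) * D ^ 4 * (1 / 1000)) +
        8 * N * (N - 1) ^ 2 * (N * D ^ 4 * (3 / 1000)) := by
        have : 0 ≤ N := by linarith
        gcongr
    _ ≤ _ := by nlinarith [show 0 ≤ (N * (N - 1)) ^ 2 * D ^ 4 by positivity]

/-- Enough samples for ‖q‖₂ allow Chebyshev's inequality with threshold halfway to ε². Fewer samples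
are admissible only if ‖p‖₂ < ‖q‖₂, which already excludes p = q. -/
theorem isL2IdentityTester_collisionTester (q : PMF X) {ε : ℝ} (hε : 0 < ε)
    (hεq : ε ≤ 2 * l2norm (probVec q)) :
    IsL2IdentityTester (collisionTester q ε) q ε (1 / 6) := by
  classical
  intro p N hN
  have h16 : (1 : ℝ) / (1 / 6) = 6 := by norm_num
  rw [h16] at hN
  set Q := l2norm (probVec q) with hQ
  by_cases hNq : 1000 * Q * Real.log 6 / ε ^ 2 ≤ N
  · have hlog := one_le_log_six
    have hQ0 : 0 < Q := by linarith
    have hQ1 : Q ≤ 1 := l2norm_probVec_le_one q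
    have hNQ : 1000 * Q ≤ N * ε ^ 2 := by
      rw [div_le_iff₀ (by positivity)] at hNq
      nlinarith
    -- From ε ≤ 2Q and Q ≤ 1 follows ε² ≤ 4Q, so the sample bound even gives N ≥ 250.
    have hN2 : (2 : ℝ) ≤ N := by
      by_contra! h
      nlinarith
    have hN1 : 1 ≤ N := by exact_mod_cast (by linarith : (1 : ℝ) ≤ N)
    have hvar := expect_pairSum_sub_sq_le p q hN1
    have hpos : (0 : ℝ) < N * (N - 1) := mul_pos (by linarith) (by linarith)
    have hT : ∀ x : Fin N → X, collisionTester q ε (List.ofFn x : Multiset X) =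
        PMF.pure (decide (pairSum (collisionKernel (probVec q)) x ≤
          N * (N - 1) * (ε ^ 2 / 2))) := by
      intro x
      rw [collisionTester_ofFn]
      congr 2
      simp only [← hQ, hNq, true_and]
    constructor
    · rintro rfl
      rw [ofReal_le_iidSamples_bind]
      have hcheb := expect_ite_le_sq_div (prodPMF fun _ : Fin N => p)
        (fun x => ¬ pairSum (collisionKernel (probVec p)) x ≤ N * (N - 1) * (ε ^ 2 / 2))
        (fun x => pairSum (collisionKernel (probVec p)) x -
          N * (N - 1) * l2norm (probVec p - probVec p) ^ 2)
        (t := N * (N - 1) * (ε ^ 2 / 2)) (by positivity) (by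
          intro x hx
          refine le_trans ?_ (le_abs_self _)
          simp only [sub_self, l2norm_sq, Pi.zero_apply]
          simp only [ne_eq, OfNat.ofNat_ne_zero, not_false_eq_true, zero_pow,
            Finset.sum_const_zero, mul_zero, sub_zero]
          exact (not_le.mp hx).le)
      have hz : expect p (fun x => (probVec p - probVec p) x ^ 2) = 0 := by
        simp [expect_const]
      rw [hz, mul_zero, add_zero] at hvar
      have hfin := hcheb.trans ((div_le_div_of_nonneg_right hvar (by positivity)).trans
        (null_variance_bound hN2 hNQ hQ0.le hε))
      have hrw : expect (prodPMF fun _ : Fin N => p) (fun x =>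
          (collisionTester p ε (List.ofFn x : Multiset X) true).toReal) =
          1 - expect (prodPMF fun _ : Fin N => p) (fun x => if ¬ pairSum
            (collisionKernel (probVec p)) x ≤ N * (N - 1) * (ε ^ 2 / 2) then 1 else 0) := by
        rw [← expect_const (prodPMF fun _ : Fin N => p) 1, ← expect_sub]
        congr 1
        funext x
        rw [hT, PMF.pure_apply, expect_const]
        by_cases h : pairSum (collisionKernel (probVec p)) x ≤ N * (N - 1) * (ε ^ 2 / 2) <;>
          simp [h]
      rw [hrw]
      linarith
    · intro hD
      rw [ofReal_le_iidSamples_bind]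
      set D := l2norm (probVec p - probVec q) with hDdef
      have hD0 : 0 < D := hε.trans hD
      have hcheb := expect_ite_le_sq_div (prodPMF fun _ : Fin N => p)
        (fun x => pairSum (collisionKernel (probVec q)) x ≤ N * (N - 1) * (ε ^ 2 / 2))
        (fun x => pairSum (collisionKernel (probVec q)) x - N * (N - 1) * D ^ 2)
        (t := N * (N - 1) * (D ^ 2 / 2)) (by positivity) (by
          intro x hx
          refine le_trans ?_ (neg_le_abs _)
          have h1 : N * (N - 1) * (ε ^ 2 / 2) ≤ N * (N - 1) * (D ^ 2 / 2) := by gcongr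
          linarith)
      have hfin := hcheb.trans ((div_le_div_of_nonneg_right hvar (by positivity)).trans
        (far_variance_bound hN2 hNQ hεq hε hD (l2norm_probVec_sq_le p q)
          (expect_sub_sq_le p q)))
      have hrw : expect (prodPMF fun _ : Fin N => p) (fun x =>
          (collisionTester q ε (List.ofFn x : Multiset X) false).toReal) =
          1 - expect (prodPMF fun _ : Fin N => p) (fun x => if pairSum
            (collisionKernel (probVec q)) x ≤ N * (N - 1) * (ε ^ 2 / 2) then 1 else 0) := by
        rw [← expect_const (prodPMF fun _ : Fin N => p) 1, ← expect_sub]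
        congr 1
        funext x
        rw [hT, PMF.pure_apply, expect_const]
        by_cases h : pairSum (collisionKernel (probVec q)) x ≤ N * (N - 1) * (ε ^ 2 / 2) <;>
          simp [h]
      rw [hrw]
      linarith
  -- Too few samples for ‖q‖₂: equality p = q contradicts the sample bound, and the tester always
  -- answers NO.
  · constructor
    · rintro rfl
      rw [min_self] at hN
      exact absurd hN hNq
    · intro _
      rw [ofReal_le_iidSamples_bind]
      have hT : ∀ x : Fin N → X,
          (collisionTester q ε (List.ofFn x : Multiset X) false).toReal = 1 := by
        intro x
        rw [collisionTester_ofFn]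
        simp only [← hQ, hNq, false_and, decide_false]
        simp
      simp only [hT, expect_const]
      norm_num

end Tester

/-! ### The law of the collected samples -/

section Algorithm

variable {d k M : ℕ}

lemma born_coarsen {X Y : Type} [Fintype X] [Fintype Y] [DecidableEq Y] (𝓜 : POVM d X)
    (f : X → Y) (ρ : DensityMatrix d) : born (𝓜.coarsen f) ρ = (born 𝓜 ρ).map f := by
  ext y
  have hnn : ∀ x, 0 ≤ ((𝓜.effect x * ρ.mat).trace.re) := fun x =>
    (Complex.nonneg_iff.mp (trace_mul_nonneg (𝓜.posSemidef x) ρ.posSemidef)).1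
  have h1 : born (𝓜.coarsen f) ρ y = ∑ x with f x = y, born 𝓜 ρ x := by
    change ENNReal.ofReal (((∑ x with f x = y, 𝓜.effect x) * ρ.mat).trace.re) =
      ∑ x with f x = y, ENNReal.ofReal ((𝓜.effect x * ρ.mat).trace.re)
    rw [← ENNReal.ofReal_sum_of_nonneg fun x _ => hnn x, Finset.sum_mul, Matrix.trace_sum,
      Complex.re_sum]
  rw [h1, PMF.map_apply, tsum_fintype, Finset.sum_filter]
  refine Finset.sum_congr rfl fun x _ => ?_
  simp only [eq_comm (a := y)]

lemma born_basisPOVM_toReal (b : OrthonormalBasis (Fin d) ℂ (EuclideanSpace ℂ (Fin d)))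
    (ρ : DensityMatrix d) (x : Fin d) :
    (born (basisPOVM b) ρ x).toReal = ((ketbra (b x) * ρ.mat).trace).re :=
  ENNReal.toReal_ofReal (trace_ketbra_mul_re_nonneg _ _)

/-- Measuring in a random basis realizes the POVM of the family. -/
lemma born_mubPOVM_eq_bind (B : BasisFamily d) (ρ : DensityMatrix d) :
    born (mubPOVM B) ρ = (PMF.uniformOfFintype (Fin (d + 1))).bind fun l =>
      (born (basisPOVM (B l)) ρ).map fun x => (x, l) := by
  classical
  ext ⟨x, l⟩
  rw [← ENNReal.toReal_eq_toReal_iff' (PMF.apply_ne_top _ _) (PMF.apply_ne_top _ _),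
    born_mubPOVM_apply, toReal_bind_apply, expect, Finset.sum_eq_single l]
  · have h : (born (basisPOVM (B l)) ρ).map (fun x => (x, l)) (x, l) =
        born (basisPOVM (B l)) ρ x := by
      rw [PMF.map_apply, tsum_eq_single x]
      · simp
      · intro x' hx'
        simp [hx'.symm]
    rw [h, born_basisPOVM_toReal]
    simp [PMF.uniformOfFintype_apply]
    left
    rw [ENNReal.toReal_add (by simp) (by simp)]
    simp
  · intro l' _ hl'
    rw [PMF.map_apply, tsum_eq_single x]
    · simp [hl'.symm]
    · simp +contextual [hl'.symm]
  · simp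

/-- The law of the outputs of the server is that of independent simulations. -/
lemma testOutput_eq (B : BasisFamily d) (S : SimProtocol d k M)
    (T : Multiset (Fin d × Fin (d + 1)) → PMF Bool) (n : ℕ) (ρ : DensityMatrix d) :
    testOutput (algMeasurement B S n) (algPost S T n) ρ =
      (prodPMF fun lj : Fin (d + 1) × Fin (n / ((d + 1) * M)) =>
        S.output (born (basisPOVM (B lj.1)) ρ)).bind fun xhat =>
      (prodPMF fun _ : Fin (n / (2 * M)) => PMF.uniformOfFintype (Fin (d + 1))).bind fun L =>
        T (collect xhat L) := by
  set R := n / ((d + 1) * M) with hR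
  set G : (Fin (d + 1) × Fin R → Option (Fin d)) → PMF Bool := fun xhat =>
    (prodPMF fun _ : Fin (n / (2 * M)) => PMF.uniformOfFintype (Fin (d + 1))).bind fun L =>
      T (collect xhat L)
  have h1 : (fun c : Copies d M n => born (algMeasurement B S n c) ρ) =
      fun c => (born (basisPOVM (B c.1)) ρ).map (S.enc c.2.2) := by
    funext c
    exact born_coarsen _ _ _
  have h2 := prodPMF_map_blocks
    (fun c : Copies d M n => (born (basisPOVM (B c.1)) ρ).map (S.enc c.2.2))
    (Equiv.prodAssoc (Fin (d + 1)) (Fin R) (Fin M))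
  have h3 : testOutput (algMeasurement B S n) (algPost S T n) ρ =
      ((prodPMF fun c : Copies d M n => (born (basisPOVM (B c.1)) ρ).map (S.enc c.2.2)).map
        fun y (a : Fin (d + 1) × Fin R) b =>
          y (Equiv.prodAssoc (Fin (d + 1)) (Fin R) (Fin M) (a, b))).bind fun z =>
        (prodPMF fun lj => S.dec (z lj)).bind G := by
    rw [testOutput, h1, PMF.bind_map]
    rfl
  rw [h3, h2, ← PMF.bind_bind, prodPMF_bind]
  congr 2
  funext lj
  have h4 := prodPMF_map (fun _ : Fin M => born (basisPOVM (B lj.1)) ρ) S.enc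
  simp only [Equiv.prodAssoc_apply]
  rw [← h4, PMF.bind_map]
  rfl

/-- A simulated output is a sample from `p`, erased independently of its value. -/
lemma output_eq_bind {S : SimProtocol d k M} (hS : S.Simulates 0.01) (p : PMF (Fin d)) :
    S.output p = ((S.output p).map Option.isSome).bind fun b =>
      p.bind fun w => PMF.pure (if b then some w else none) := by
  classical
  set q := S.output p
  obtain ⟨hf, hx⟩ := hS p
  have hlt : q none < 1 := hf.trans_lt (by
    rw [← ENNReal.ofReal_one]
    exact (ENNReal.ofReal_lt_ofReal_iff zero_lt_one).mpr (by norm_num))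
  have hs : ∀ x, q (some x) = (1 - q none) * p x := fun x => by
    rw [← hx x, ENNReal.mul_div_cancel (tsub_pos_of_lt hlt).ne'
      (tsub_le_self.trans_lt ENNReal.one_lt_top).ne]
  have hfalse : q.map Option.isSome false = q none := by
    rw [PMF.map_apply, tsum_fintype, Fintype.sum_option]
    simp
  have htrue : q.map Option.isSome true = 1 - q none := by
    rw [PMF.map_apply, tsum_fintype, Fintype.sum_option]
    simp [hs, ← Finset.mul_sum, pmf_sum_eq_one]
  ext o
  rw [PMF.bind_apply, tsum_fintype, Fintype.sum_bool, htrue, hfalse]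
  rcases o with _ | x
  · simp [PMF.bind_apply, tsum_fintype]
  · rw [hs]
    simp [PMF.bind_apply, tsum_fintype, PMF.pure_apply]

/-- The simulated outputs with success pattern `σ` and values `w`. -/
def erase {ι X : Type} (σ : ι → Bool) (w : ι → X) : ι → Option X :=
  fun i => if σ i then some (w i) else none

/-- Success pattern and values become independent, so a selection rule that looks only at the
pattern does not bias the values. -/
lemma prodPMF_output_eq {ι : Type} [Fintype ι] [DecidableEq ι] {S : SimProtocol d k M}
    (hS : S.Simulates 0.01) (p : ι → PMF (Fin d)) :
    (prodPMF fun i => S.output (p i)) =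
      (prodPMF fun i => (S.output (p i)).map Option.isSome).bind fun σ =>
        (prodPMF p).bind fun w => PMF.pure (erase σ w) := by
  have h1 : (fun i => S.output (p i)) = fun i => ((S.output (p i)).map Option.isSome).bind fun b =>
      (p i).bind fun w => PMF.pure (if b then some w else none) :=
    funext fun i => output_eq_bind hS (p i)
  rw [h1, ← prodPMF_bind]
  congr 1
  funext σ
  rw [← prodPMF_bind]
  congr 1
  funext w
  exact prodPMF_pure _

lemma filterMap_ite {α β : Type} (σ : α → Bool) (w : α → β) (l : List α) :
    (l.filterMap fun j => if σ j then some (w j) else none) = (l.filter σ).map w := by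
  induction l with
  | nil => rfl
  | cons a l ih =>
    by_cases h : σ a <;> simp [h, ih]

lemma map_eq_ofFn_get {α β : Type} (l : List α) (g : α → β) :
    l.map g = List.ofFn fun i => g (l.get i) := by
  have h : List.map g (List.ofFn l.get) = List.ofFn (g ∘ l.get) := List.map_ofFn
  rw [List.ofFn_get] at h
  exact h

lemma coe_ofFn_eq_sum {α : Type} {N : ℕ} (f : Fin N → α) :
    ((List.ofFn f : List α) : Multiset α) = ∑ i, {f i} := by
  rw [← Fin.univ_val_map]
  change _ = (Finset.univ.val.map fun i => ({f i} : Multiset α)).sum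
  rw [← Multiset.bind_singleton]
  rfl

/-- Enough outputs of every group are successful. -/
def Enough {R N : ℕ} (σ : Fin (d + 1) × Fin R → Bool) (L : Fin N → Fin (d + 1)) : Prop :=
  ∀ l, (Finset.univ.filter fun t => L t = l).card ≤
    (Finset.univ.filter fun j => σ (l, j) = true).card

/-- If enough outputs are successful, the collected samples sit at positions that do not depend
on the values of the samples. -/
lemma exists_collect_eq {R N : ℕ} {σ : Fin (d + 1) × Fin R → Bool} {L : Fin N → Fin (d + 1)}
    (h : Enough σ L) :
    ∃ e : Fin N → Fin (d + 1) × Fin R, Function.Injective e ∧ (∀ t, (e t).1 = L t) ∧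
      ∀ w : Fin (d + 1) × Fin R → Fin d,
        collect (erase σ w) L = (List.ofFn fun t => (w (e t), L t) : List _) := by
  classical
  let m : Fin (d + 1) → ℕ := fun l => (Finset.univ.filter fun t => L t = l).card
  -- The positions of the kept outputs of group `l`: the first `m l` successes.
  let J : Fin (d + 1) → List (Fin R) := fun l =>
    ((List.finRange R).filter fun j => σ (l, j)).take (m l)
  have hJnodup : ∀ l, (J l).Nodup := fun l =>
    ((List.nodup_finRange R).filter _).sublist (List.take_sublist _ _)
  have hJlen : ∀ l, (J l).length = m l := by
    intro l
    have h1 : ((List.finRange R).filter fun j => σ (l, j)).length =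
        (Finset.univ.filter fun j => σ (l, j) = true).card := by
      rw [← List.toFinset_card_of_nodup ((List.nodup_finRange R).filter _)]
      congr 1
      ext j
      simp
    rw [List.length_take, h1]
    exact min_eq_left (h l)
  have hcard : ∀ l, Fintype.card {t // L t = l} = Fintype.card (Fin (J l).length) := by
    intro l
    rw [Fintype.card_fin, hJlen, Fintype.card_subtype]
  -- Any bijection serves, since the tester sees only the multiset.
  let f : ∀ l, {t // L t = l} ≃ Fin (J l).length := fun l => Fintype.equivOfCardEq (hcard l)
  let e : Fin N → Fin (d + 1) × Fin R := fun t => (L t, (J (L t)).get (f (L t) ⟨t, rfl⟩))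
  have he : ∀ l (t : {t // L t = l}), e t = (l, (J l).get (f l t)) := by
    rintro l ⟨t, rfl⟩
    rfl
  refine ⟨e, ?_, fun t => rfl, fun w => ?_⟩
  · intro t t' htt
    have h1 : L t = L t' := congrArg Prod.fst htt
    have h2 := he (L t') ⟨t, h1⟩
    have h3 := he (L t') ⟨t', rfl⟩
    rw [h2, h3] at htt
    have h4 := (f (L t')).injective ((List.nodup_iff_injective_get.mp (hJnodup _))
      (congrArg Prod.snd htt))
    exact congrArg Subtype.val h4
  · rw [coe_ofFn_eq_sum, ← Fintype.sum_fiberwise L, collect]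
    refine Finset.sum_congr rfl fun l _ => ?_
    have h1 : (List.ofFn fun j => erase σ w (l, j)).reduceOption =
        ((List.finRange R).filter fun j => σ (l, j)).map fun j => w (l, j) := by
      rw [List.reduceOption, List.ofFn_eq_map, List.filterMap_map]
      exact filterMap_ite (fun j => σ (l, j)) (fun j => w (l, j)) _
    have h2 : (((List.ofFn fun j => erase σ w (l, j)).reduceOption.take
        (Finset.univ.filter fun t => L t = l).card).map fun x => (x, l)) =
        List.ofFn fun i => (w (l, (J l).get i), l) := by
      rw [h1, ← List.map_take, List.map_map]
      exact map_eq_ofFn_get (J l) _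
    rw [h2, coe_ofFn_eq_sum, ← (f l).sum_comp]
    refine Finset.sum_congr rfl fun t _ => ?_
    rw [he l t, t.2]

/-- For fixed labels and a fixed success pattern with enough successes, the collected samples are
independent. -/
lemma expect_collect_eq {R N : ℕ} {σ : Fin (d + 1) × Fin R → Bool} {L : Fin N → Fin (d + 1)}
    (h : Enough σ L) (p : Fin (d + 1) → PMF (Fin d))
    (F : Multiset (Fin d × Fin (d + 1)) → ℝ) :
    expect (prodPMF fun lj : Fin (d + 1) × Fin R => p lj.1) (fun w => F (collect (erase σ w) L)) =
      expect (prodPMF fun t => p (L t)) fun y => F (List.ofFn fun t => (y t, L t) : List _) := by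
  obtain ⟨e, he, heL, hc⟩ := exists_collect_eq h
  have h1 := prodPMF_map_comp (fun lj : Fin (d + 1) × Fin R => p lj.1) e he
  have h2 : (fun lj : Fin (d + 1) × Fin R => p lj.1) ∘ e = fun t => p (L t) :=
    funext fun t => congrArg p (heL t)
  rw [h2] at h1
  rw [← h1, expect_map]
  simp only [hc]
  rfl

/-- Independent samples with independent uniform labels are samples from the outcome distribution
of the POVM of the family. -/
lemma expect_labels_eq (B : BasisFamily d) (ρ : DensityMatrix d) (N : ℕ)
    (F : Multiset (Fin d × Fin (d + 1)) → ℝ) :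
    expect (prodPMF fun _ : Fin N => PMF.uniformOfFintype (Fin (d + 1))) (fun L =>
      expect (prodPMF fun t => born (basisPOVM (B (L t))) ρ) fun y =>
        F (List.ofFn fun t => (y t, L t) : List _)) =
      expect (prodPMF fun _ : Fin N => born (mubPOVM B) ρ) fun x => F (List.ofFn x : List _) := by
  rw [born_mubPOVM_eq_bind, ← prodPMF_bind, expect_bind]
  congr 1
  funext L
  rw [← prodPMF_map (fun t => born (basisPOVM (B (L t))) ρ) fun t x => (x, L t), expect_map]

end Algorithm

/-! ### Shortage probability, constants and the final error bound -/

section Certification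

variable {d k M : ℕ}

lemma expect_isSome_ge {S : SimProtocol d k M} (hS : S.Simulates 0.01) (p : PMF (Fin d)) :
    0.99 ≤ expect ((S.output p).map Option.isSome) fun b => if b then 1 else 0 := by
  rw [expect_map, expect, Fintype.sum_option]
  have h1 := sum_toReal_eq_one (S.output p)
  rw [Fintype.sum_option] at h1
  have h2 : (S.output p none).toReal ≤ 0.01 :=
    ENNReal.toReal_le_of_le_ofReal (by norm_num) (hS p).1
  simp only [Option.isSome_none, Option.isSome_some, Bool.false_eq_true, if_false, if_true,
    mul_zero, mul_one, zero_add]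
  linarith

lemma expect_indicator_le_one {X : Type} [Fintype X] (p : PMF X) (P : X → Prop)
    [DecidablePred P] : expect p (fun x => if P x then 1 else 0) ≤ 1 := by
  rw [← expect_const p 1]
  refine expect_mono p fun x => ?_
  rw [expect_const]
  split_ifs <;> norm_num

/-- The variance of an indicator is at most its mean. -/
lemma variance_indicator {X : Type} [Fintype X] (p : PMF X) (P : X → Prop) [DecidablePred P] :
    expect p (fun x => ((if P x then 1 else 0) - expect p fun x => if P x then 1 else 0) ^ 2) ≤
      expect p fun x => if P x then 1 else 0 := by
  set π := expect p fun x => if P x then (1 : ℝ) else 0 with hπ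
  have h : ∀ x, ((if P x then (1 : ℝ) else 0) - π) ^ 2 =
      (1 - 2 * π) * (if P x then 1 else 0) + π ^ 2 := fun x => by split_ifs <;> ring
  simp only [h]
  rw [expect_add, expect_mul_left, expect_const, ← hπ]
  nlinarith [sq_nonneg π]

lemma expect_sub_mean {X : Type} [Fintype X] (p : PMF X) (f : X → ℝ) :
    expect p (fun x => f x - expect p f) = 0 := by
  rw [expect_sub, expect_const, sub_self]

/-- Few successes in a group are unlikely. -/
lemma expect_few_successes_le {R : ℕ} (hR : 0 < R) {S : SimProtocol d k M}
    (hS : S.Simulates 0.01) (p : Fin (d + 1) → PMF (Fin d)) (l : Fin (d + 1)) :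
    expect (prodPMF fun lj : Fin (d + 1) × Fin R => (S.output (p lj.1)).map Option.isSome)
      (fun σ => if ((Finset.univ.filter fun j => σ (l, j) = true).card : ℝ) < 3 / 4 * R
        then 1 else 0) ≤ 18 / R := by
  have hR' : (0 : ℝ) < R := by exact_mod_cast hR
  set π := expect ((S.output (p l)).map Option.isSome) fun b => if b then (1 : ℝ) else 0 with hπ
  have hπ1 : 0.99 ≤ π := expect_isSome_ge hS _
  have hsum := expect_sum_sq
    (fun lj : Fin (d + 1) × Fin R => (S.output (p lj.1)).map Option.isSome)
    ({l} ×ˢ Finset.univ) (fun lj b => (if b then (1 : ℝ) else 0) -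
      expect ((S.output (p lj.1)).map Option.isSome) fun b => if b then (1 : ℝ) else 0)
    (fun lj _ => expect_sub_mean _ _)
  simp only [Finset.sum_product, Finset.sum_singleton, Finset.sum_const, Finset.card_univ,
    Fintype.card_fin, nsmul_eq_mul, ← hπ] at hsum
  have hvar : expect ((S.output (p l)).map Option.isSome)
      (fun b => ((if b then (1 : ℝ) else 0) - π) ^ 2) ≤ 1 :=
    (variance_indicator _ fun b : Bool => b = true).trans (expect_indicator_le_one _ _)
  -- The gap is 0.99 - 0.75 = 0.24 per block, and 1/0.24² < 18.
  have hcheb := expect_ite_le_sq_div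
    (prodPMF fun lj : Fin (d + 1) × Fin R => (S.output (p lj.1)).map Option.isSome)
    (fun σ => ((Finset.univ.filter fun j => σ (l, j) = true).card : ℝ) < 3 / 4 * R)
    (fun σ => ∑ j, ((if σ (l, j) then (1 : ℝ) else 0) - π)) (t := 0.24 * R) (by positivity) (by
      intro σ hσ
      refine le_trans ?_ (neg_le_abs _)
      rw [Finset.sum_sub_distrib, Finset.sum_boole, Finset.sum_const, Finset.card_univ,
        Fintype.card_fin, nsmul_eq_mul]
      nlinarith)
  refine hcheb.trans ?_
  rw [hsum, div_le_div_iff₀ (by positivity) hR']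
  nlinarith

/-- Many occurrences of a label are unlikely. -/
lemma expect_many_labels_le {R N : ℕ} (hR : 0 < R)
    (hN : (N : ℝ) / ((d : ℝ) + 1) ≤ 11 / 20 * R) (l : Fin (d + 1)) :
    expect (prodPMF fun _ : Fin N => PMF.uniformOfFintype (Fin (d + 1)))
      (fun L => if 3 / 4 * (R : ℝ) < ((Finset.univ.filter fun t => L t = l).card : ℝ)
        then 1 else 0) ≤ 14 / R := by
  have hR' : (0 : ℝ) < R := by exact_mod_cast hR
  have hu : expect (PMF.uniformOfFintype (Fin (d + 1))) (fun a => if a = l then (1 : ℝ) else 0) =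
      ((d : ℝ) + 1)⁻¹ := by
    rw [expect]
    simp only [mul_ite, mul_one, mul_zero, Finset.sum_ite_eq', Finset.mem_univ, if_true,
      PMF.uniformOfFintype_apply, Fintype.card_fin, ENNReal.toReal_inv, ENNReal.toReal_natCast]
    push_cast
    rfl
  have hvar := variance_indicator (PMF.uniformOfFintype (Fin (d + 1))) fun a => a = l
  have hmean := expect_sub_mean (PMF.uniformOfFintype (Fin (d + 1)))
    fun a => if a = l then (1 : ℝ) else 0
  rw [hu] at hvar hmean
  have hsum := expect_sum_sq (fun _ : Fin N => PMF.uniformOfFintype (Fin (d + 1))) Finset.univ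
    (fun _ a => (if a = l then (1 : ℝ) else 0) - ((d : ℝ) + 1)⁻¹) fun _ _ => hmean
  rw [Finset.sum_const, Finset.card_univ, Fintype.card_fin, nsmul_eq_mul] at hsum
  rw [div_eq_mul_inv] at hN
  -- The gap is 3/4 - 11/20 = 1/5, the variance is at most 11R/20, and (11/20) · 25 < 14.
  have hcheb := expect_ite_le_sq_div
    (prodPMF fun _ : Fin N => PMF.uniformOfFintype (Fin (d + 1)))
    (fun L => 3 / 4 * (R : ℝ) < ((Finset.univ.filter fun t => L t = l).card : ℝ))
    (fun L => ∑ t, ((if L t = l then (1 : ℝ) else 0) - ((d : ℝ) + 1)⁻¹)) (t := 1 / 5 * R)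
    (by positivity) (by
      intro L hL
      refine le_trans ?_ (le_abs_self _)
      rw [Finset.sum_sub_distrib, Finset.sum_boole, Finset.sum_const, Finset.card_univ,
        Fintype.card_fin, nsmul_eq_mul]
      linarith)
  refine hcheb.trans ?_
  rw [hsum, div_le_div_iff₀ (by positivity) hR']
  have h1 := (mul_le_mul_of_nonneg_left hvar (Nat.cast_nonneg N)).trans hN
  nlinarith

open Classical in
lemma indicator_not_enough_le {R N : ℕ} (σ : Fin (d + 1) × Fin R → Bool)
    (L : Fin N → Fin (d + 1)) :
    (if Enough σ L then (0 : ℝ) else 1) ≤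
      ∑ l, (if ((Finset.univ.filter fun j => σ (l, j) = true).card : ℝ) < 3 / 4 * R
        then 1 else 0) +
      ∑ l, if 3 / 4 * (R : ℝ) < ((Finset.univ.filter fun t => L t = l).card : ℝ)
        then 1 else 0 := by
  have h0 : ∀ P : Prop, (0 : ℝ) ≤ if P then 1 else 0 := fun P => by split_ifs <;> norm_num
  split_ifs with h
  · exact add_nonneg (Finset.sum_nonneg fun l _ => h0 _) (Finset.sum_nonneg fun l _ => h0 _)
  · unfold Enough at h
    -- A shortage in group `l` means demand above supply, so one of the two lies on the wrong side
    -- of 3R/4.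
    push Not at h
    obtain ⟨l, hl⟩ := h
    rw [← Finset.sum_add_distrib]
    refine le_trans ?_ (Finset.single_le_sum (fun l _ => add_nonneg (h0 _) (h0 _))
      (Finset.mem_univ l))
    by_cases h1 : ((Finset.univ.filter fun j => σ (l, j) = true).card : ℝ) < 3 / 4 * R
    · rw [if_pos h1]
      linarith [h0 (3 / 4 * (R : ℝ) < ((Finset.univ.filter fun t => L t = l).card : ℝ))]
    · have h2 : ((Finset.univ.filter fun j => σ (l, j) = true).card : ℝ) <
          ((Finset.univ.filter fun t => L t = l).card : ℝ) := by exact_mod_cast hl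
      rw [if_neg h1, if_pos (by linarith)]
      norm_num

open Classical in
lemma expect_not_enough_le {R N : ℕ} (hR : 192 * (d + 1) ≤ R)
    (hN : (N : ℝ) / ((d : ℝ) + 1) ≤ 11 / 20 * R) {S : SimProtocol d k M}
    (hS : S.Simulates 0.01) (p : Fin (d + 1) → PMF (Fin d)) :
    expect (prodPMF fun lj : Fin (d + 1) × Fin R => (S.output (p lj.1)).map Option.isSome)
      (fun σ => expect (prodPMF fun _ : Fin N => PMF.uniformOfFintype (Fin (d + 1)))
        fun L => if Enough σ L then (0 : ℝ) else 1) ≤ 1 / 6 := by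
  have hR0 : 0 < R := by omega
  have hR' : (0 : ℝ) < R := by exact_mod_cast hR0
  have hR2 : 192 * ((d : ℝ) + 1) ≤ R := by exact_mod_cast hR
  refine (expect_mono _ fun σ => expect_mono _ fun L => indicator_not_enough_le σ L).trans ?_
  simp only [expect_add, expect_const, expect_sum]
  -- The union bound gives 32(d + 1)/R, and 32/192 = 1/6.
  calc _ ≤ ∑ _l : Fin (d + 1), 18 / (R : ℝ) + ∑ _l : Fin (d + 1), 14 / (R : ℝ) :=
        add_le_add (Finset.sum_le_sum fun l _ => expect_few_successes_le hR0 hS p l)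
          (Finset.sum_le_sum fun l _ => expect_many_labels_le hR0 hN l)
    _ ≤ 1 / 6 := by
        simp only [Finset.sum_const, Finset.card_univ, Fintype.card_fin, nsmul_eq_mul]
        push_cast
        rw [← mul_add, ← add_div, mul_div_assoc', div_le_iff₀ hR']
        linarith

/-- The algorithm answers correctly about as often as the tester does on i.i.d. samples. -/
lemma testOutput_ge (B : BasisFamily d) {S : SimProtocol d k M} (hS : S.Simulates 0.01)
    (T : Multiset (Fin d × Fin (d + 1)) → PMF Bool) (n : ℕ) (ρ : DensityMatrix d) (b : Bool)
    (hR : 192 * (d + 1) ≤ n / ((d + 1) * M))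
    (hN : ((n / (2 * M) : ℕ) : ℝ) / ((d : ℝ) + 1) ≤ 11 / 20 * (n / ((d + 1) * M) : ℕ))
    (hT : ENNReal.ofReal (1 - 1 / 6) ≤
      (iidSamples (born (mubPOVM B) ρ) (n / (2 * M))).bind T b) :
    2 / 3 ≤ testOutput (algMeasurement B S n) (algPost S T n) ρ b := by
  classical
  rw [ofReal_le_iidSamples_bind] at hT
  have h23 : (2 / 3 : ℝ≥0∞) = ENNReal.ofReal (2 / 3) := by
    rw [ENNReal.ofReal_div_of_pos (by norm_num)]; simp
  rw [h23, ENNReal.ofReal_le_iff_le_toReal (PMF.apply_ne_top _ _), testOutput_eq,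
    toReal_bind_apply]
  set R := n / ((d + 1) * M)
  set N := n / (2 * M)
  set p : Fin (d + 1) → PMF (Fin d) := fun l => born (basisPOVM (B l)) ρ with hp
  set Pσ := prodPMF fun lj : Fin (d + 1) × Fin R => (S.output (p lj.1)).map Option.isSome
  set PL := prodPMF fun _ : Fin N => PMF.uniformOfFintype (Fin (d + 1))
  set F : Multiset (Fin d × Fin (d + 1)) → ℝ := fun s => (T s b).toReal with hF
  have hF0 : ∀ s, 0 ≤ F s := fun s => ENNReal.toReal_nonneg
  have hF1 : ∀ s, F s ≤ 1 := fun s => toReal_apply_le_one _ _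
  have hbad := expect_not_enough_le hR hN hS p
  have hlab := expect_labels_eq B ρ N F
  set G : (Fin N → Fin (d + 1)) → ℝ := fun L =>
    expect (prodPMF fun t => p (L t)) fun y => F (List.ofFn fun t => (y t, L t) : List _) with hG
  have hG1 : ∀ L, G L ≤ 1 := fun L => by
    rw [hG, ← expect_const (prodPMF fun t => p (L t)) 1]
    exact expect_mono _ fun y => hF1 _
  have hlaw : expect (prodPMF fun lj : Fin (d + 1) × Fin R => S.output (p lj.1)) (fun xhat =>
      (PL.bind (fun L => T (collect xhat L)) b).toReal) =
      expect Pσ fun σ => expect PL fun L =>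
        expect (prodPMF fun lj : Fin (d + 1) × Fin R => p lj.1) fun w =>
          F (collect (erase σ w) L) := by
    rw [prodPMF_output_eq hS fun lj : Fin (d + 1) × Fin R => p lj.1, expect_bind]
    congr 1
    funext σ
    rw [expect_bind]
    simp only [expect_pure, toReal_bind_apply]
    rw [expect_comm]
  rw [hlaw]
  -- Since `G ≤ 1`, a shortage costs at most its own probability.
  have hstep : expect Pσ (fun σ => expect PL fun L => G L - if Enough σ L then 0 else 1) ≤
      expect Pσ fun σ => expect PL fun L =>
        expect (prodPMF fun lj : Fin (d + 1) × Fin R => p lj.1) fun w =>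
          F (collect (erase σ w) L) := by
    refine expect_mono _ fun σ => expect_mono _ fun L => ?_
    by_cases h : Enough σ L
    · rw [if_pos h, sub_zero, expect_collect_eq h p F]
    · rw [if_neg h]
      exact (sub_nonpos.mpr (hG1 L)).trans (expect_nonneg _ fun w => hF0 _)
  simp only [expect_sub, expect_const] at hstep
  have hlab' : expect PL G = expect (prodPMF fun _ : Fin N => born (mubPOVM B) ρ)
      fun x => F (List.ofFn x : List _) := hlab
  rw [hlab'] at hstep
  linarith

lemma card_copies_le (d M n : ℕ) : Fintype.card (Copies d M n) ≤ n := by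
  simp only [Copies, Fintype.card_prod, Fintype.card_fin]
  calc (d + 1) * (n / ((d + 1) * M) * M) = n / ((d + 1) * M) * ((d + 1) * M) := by ring
    _ ≤ n := Nat.div_mul_le_self _ _

/-- The number of players is of order `d / k`. -/
lemma numPlayers_bounds {d k : ℕ} (hk : 2 ≤ k) (hkd : k < d) :
    0 < numPlayers d k ∧
      (numPlayers d k : ℝ) * k ≤ 160 * ⌈Real.logb 2 (1 / 0.01)⌉₊ * d := by
  have hc := one_le_ceil_logb
  rw [numPlayers]
  set c := ⌈Real.logb 2 (1 / 0.01)⌉₊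
  set m := ⌈(d : ℝ) / ((k : ℝ) - 1)⌉₊ with hm
  have hk' : (2 : ℝ) ≤ k := by exact_mod_cast hk
  have hkd' : (k : ℝ) < d := by exact_mod_cast hkd
  have hpos : 0 < (d : ℝ) / ((k : ℝ) - 1) := div_pos (by linarith) (by linarith)
  have hm0 : 0 < m := Nat.ceil_pos.mpr hpos
  refine ⟨by positivity, ?_⟩
  have h1 : (m : ℝ) < (d : ℝ) / ((k : ℝ) - 1) + 1 := Nat.ceil_lt_add_one hpos.le
  -- m(k - 1) < d + (k - 1) < 2d, and k ≤ 2(k - 1).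
  have h2 : (m : ℝ) * k ≤ 4 * d := by
    have h3 : (m : ℝ) * ((k : ℝ) - 1) < d + ((k : ℝ) - 1) := by
      rw [div_add_one (by linarith), lt_div_iff₀ (by linarith)] at h1
      exact h1
    nlinarith
  push_cast
  calc (40 : ℝ) * c * m * k = 40 * c * (m * k) := by ring
    _ ≤ 40 * c * (4 * d) := by gcongr
    _ = _ := by ring

lemma log_six_le_two : Real.log 6 ≤ 2 := by
  rw [Real.log_le_iff_le_exp (by norm_num)]
  have h : Real.exp 2 = Real.exp 1 * Real.exp 1 := by rw [← Real.exp_add]; norm_num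
  nlinarith [Real.exp_one_gt_d9]

/-- The numerical consequences of the lower bound on the number of copies. -/
lemma copies_bounds {d k n : ℕ} {ε : ℝ} (hk : 2 ≤ k) (hkd : k < d) (hε : 0 < ε) (hε2 : ε ≤ 2)
    (hn : 10 ^ 7 * (⌈Real.logb 2 (1 / 0.01)⌉₊ : ℝ) * (d : ℝ) ^ 3 / (k * ε ^ 2) ≤ n) :
    192 * (d + 1) ≤ n / ((d + 1) * numPlayers d k) ∧
    ((n / (2 * numPlayers d k) : ℕ) : ℝ) / ((d : ℝ) + 1) ≤
      11 / 20 * (n / ((d + 1) * numPlayers d k) : ℕ) ∧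
    6000 * (d : ℝ) ^ 2 / ε ^ 2 ≤ (n / (2 * numPlayers d k) : ℕ) := by
  obtain ⟨hM0, hMk⟩ := numPlayers_bounds hk hkd
  have hc1 : (1 : ℝ) ≤ (⌈Real.logb 2 (1 / 0.01)⌉₊ : ℝ) := by exact_mod_cast one_le_ceil_logb
  set M := numPlayers d k
  set c : ℝ := (⌈Real.logb 2 (1 / 0.01)⌉₊ : ℝ)
  have hM0' : (0 : ℝ) < M := by exact_mod_cast hM0
  have hd : (3 : ℝ) ≤ d := by exact_mod_cast (by omega : 3 ≤ d)
  have hk0 : (0 : ℝ) < k := by exact_mod_cast (by omega : 0 < k)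
  have hε4 : ε ^ 2 ≤ 4 := by nlinarith
  have hε0 : 0 < ε ^ 2 := by positivity
  rw [div_le_iff₀ (by positivity)] at hn
  -- 62500 = 10⁷/160, with 160 coming from the bound on the number of players.
  have hnM : 62500 * (M : ℝ) * d ^ 2 ≤ n * ε ^ 2 := by
    have h1 : 62500 * ((M : ℝ) * k) * d ^ 2 ≤ 62500 * (160 * c * d) * d ^ 2 := by gcongr
    have h2 : 62500 * (M : ℝ) * d ^ 2 * k ≤ n * ε ^ 2 * k := by nlinarith
    exact le_of_mul_le_mul_right h2 hk0
  have hR : 192 * (d + 1) ≤ n / ((d + 1) * M) := by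
    rw [Nat.le_div_iff_mul_le (by positivity)]
    have h1 : (192 * ((d : ℝ) + 1)) * (((d : ℝ) + 1) * M) ≤ n := by
      have h2 : ((d : ℝ) + 1) ^ 2 ≤ 4 * d ^ 2 := by nlinarith
      have h3 : 192 * M * ((d : ℝ) + 1) ^ 2 ≤ 192 * M * (4 * d ^ 2) := by gcongr
      have h4 : (n : ℝ) * ε ^ 2 ≤ n * 4 := by gcongr
      nlinarith [mul_pos hM0' (by positivity : (0 : ℝ) < d ^ 2)]
    exact_mod_cast h1
  refine ⟨hR, ?_, ?_⟩
  -- The mean demand per label is below (R + 1)/2. The slack between 1/2 and 11/20 absorbs the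
  -- rounding because R is large.
  · have h1 : ((n / (2 * M) : ℕ) : ℝ) ≤ n / (2 * M) := by
      refine Nat.cast_div_le.trans_eq ?_
      push_cast
      rfl
    have h2 : (n : ℝ) / ((d + 1) * M) < (n / ((d + 1) * M) : ℕ) + 1 := by
      have h := Nat.lt_div_mul_add (a := n) (b := (d + 1) * M) (by positivity)
      rw [div_lt_iff₀ (by positivity)]
      have h' : (n : ℝ) < (n / ((d + 1) * M) : ℕ) * ((d + 1) * M) + (d + 1) * M := by
        exact_mod_cast h
      linarith
    have h3 : (192 : ℝ) * ((d : ℝ) + 1) ≤ (n / ((d + 1) * M) : ℕ) := by exact_mod_cast hR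
    have h4 : (n : ℝ) / (2 * M) / ((d : ℝ) + 1) = n / ((d + 1) * M) / 2 := by
      field_simp
    have h5 := div_le_div_of_nonneg_right h1 (by linarith : (0 : ℝ) ≤ (d : ℝ) + 1)
    rw [h4] at h5
    linarith
  · have h2 : (n : ℝ) / (2 * M) < (n / (2 * M) : ℕ) + 1 := by
      have h := Nat.lt_div_mul_add (a := n) (b := 2 * M) (by positivity)
      rw [div_lt_iff₀ (by positivity)]
      have h' : (n : ℝ) < (n / (2 * M) : ℕ) * (2 * M) + 2 * M := by exact_mod_cast h
      linarith
    have h3 : 31250 * (d : ℝ) ^ 2 / ε ^ 2 ≤ n / (2 * M) := by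
      rw [div_le_div_iff₀ hε0 (by positivity)]
      linarith
    -- This absorbs the sample lost to rounding: 31250t - 1 ≥ 6000t for t ≥ 1.
    have h4 : 1 ≤ (d : ℝ) ^ 2 / ε ^ 2 := by
      rw [one_le_div hε0]
      nlinarith
    rw [mul_div_assoc] at h3 ⊢
    linarith

end Certification

/-! ### Assembly of the theorem -/

theorem mainTheorem9 :
    ∃ C : ℝ, 0 < C ∧ ∀ d k : ℕ, 2 ≤ k → k < d →
      -- the ingredients of the algorithm exist
      ((∃ a : ℕ, d = 2 ^ a) → ∃ B : BasisFamily d, IsMaximalMUB B) ∧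
      (∃ S : SimProtocol d k (numPlayers d k), S.Simulates 0.01) ∧
      ∀ B : BasisFamily d, IsMaximalMUB B →
        ∀ (ρ₀ : DensityMatrix d) (ε : ℝ), 0 < ε → ε ≤ 2 →
          (∃ T : Multiset (Fin d × Fin (d + 1)) → PMF Bool,
            IsL2IdentityTester T (born (mubPOVM B) ρ₀) (ε / ((d + 1) * Real.sqrt d)) (1 / 6)) ∧
          -- and with any choice of them the algorithm certifies `ρ₀`
          ∀ (S : SimProtocol d k (numPlayers d k)) (T : Multiset (Fin d × Fin (d + 1)) → PMF Bool),
            S.Simulates 0.01 →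
            IsL2IdentityTester T (born (mubPOVM B) ρ₀) (ε / ((d + 1) * Real.sqrt d)) (1 / 6) →
            ∀ n : ℕ, C * (d : ℝ) ^ 3 / (k * ε ^ 2) ≤ n →
              Fintype.card (Copies d (numPlayers d k) n) ≤ n ∧
              Certifies (algMeasurement B S n) (algPost S T n) ρ₀ ε := by
  have hc1 : (1 : ℝ) ≤ (⌈Real.logb 2 (1 / 0.01)⌉₊ : ℝ) := by exact_mod_cast one_le_ceil_logb
  refine ⟨10 ^ 7 * (⌈Real.logb 2 (1 / 0.01)⌉₊ : ℝ), by positivity, fun d k hk hkd => ⟨?_,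
    exists_simulates hk, fun B hB ρ₀ ε hε hε2 => ?_⟩⟩
  · rintro ⟨a, rfl⟩
    refine exists_maximalMUB_two_pow ?_
    rintro rfl
    omega
  have hd0 : 0 < d := by omega
  have hd : (3 : ℝ) ≤ d := by exact_mod_cast (by omega : 3 ≤ d)
  have hsqrt : 1 ≤ Real.sqrt d := Real.one_le_sqrt.mpr (by linarith)
  have hε' : 0 < ε / (((d : ℝ) + 1) * Real.sqrt d) := by positivity
  refine ⟨⟨_, isL2IdentityTester_collisionTester _ hε' ?_⟩, fun S T hS hT n hn =>
    ⟨card_copies_le _ _ _, ?_⟩⟩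
  -- ε' ≤ 2/(d + 1) ≤ 2‖p_{ρ₀}‖₂, by ε ≤ 2 and √d ≥ 1.
  · refine le_trans ?_ (mul_le_mul_of_nonneg_left (le_l2norm_born_mubPOVM hB ρ₀) zero_le_two)
    rw [mul_one_div, div_le_div_iff₀ (by positivity) (by positivity)]
    have h1 : (2 : ℝ) * (d + 1) ≤ 2 * ((d + 1) * Real.sqrt d) := by nlinarith
    nlinarith
  obtain ⟨hR, hN, hNd⟩ := copies_bounds hk hkd hε hε2 hn
  have hsamples : ∀ p : PMF (Fin d × Fin (d + 1)),
      1000 * min (l2norm (probVec p)) (l2norm (probVec (born (mubPOVM B) ρ₀))) *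
        Real.log (1 / (1 / 6)) / (ε / (((d : ℝ) + 1) * Real.sqrt d)) ^ 2 ≤
      (n / (2 * numPlayers d k) : ℕ) := by
    intro p
    refine le_trans ?_ hNd
    have h16 : (1 : ℝ) / (1 / 6) = 6 := by norm_num
    rw [h16]
    have h1 : min (l2norm (probVec p)) (l2norm (probVec (born (mubPOVM B) ρ₀))) ≤
        (3 / 2) / ((d : ℝ) + 1) := (min_le_right _ _).trans (l2norm_born_mubPOVM_le hB ρ₀)
    have hlog0 : 0 ≤ Real.log 6 := zero_le_one.trans one_le_log_six
    -- The minimum is bounded through ‖p_{ρ₀}‖₂, so the required number of samples is the same for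
    -- every unknown `p`.
    calc 1000 * min (l2norm (probVec p)) (l2norm (probVec (born (mubPOVM B) ρ₀))) *
          Real.log 6 / (ε / (((d : ℝ) + 1) * Real.sqrt d)) ^ 2
        ≤ 1000 * ((3 / 2) / ((d : ℝ) + 1)) * 2 / (ε / (((d : ℝ) + 1) * Real.sqrt d)) ^ 2 := by
          gcongr
          exact log_six_le_two
      _ = 3000 * (((d : ℝ) + 1) * d) / ε ^ 2 := by
          rw [div_pow, mul_pow, Real.sq_sqrt (by linarith)]
          field_simp
          norm_num
      _ ≤ 6000 * (d : ℝ) ^ 2 / ε ^ 2 := by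
          refine div_le_div_of_nonneg_right ?_ (by positivity)
          nlinarith
  constructor
  · exact testOutput_ge B hS T n ρ₀ true hR hN ((hT _ _ (hsamples _)).1 rfl)
  · intro ρ hρ
    exact testOutput_ge B hS T n ρ false hR hN ((hT _ _ (hsamples _)).2
      (lt_l2norm_sub_of_lt_traceNorm hB ρ ρ₀ hd0 hρ))
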